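/- Let $a\ge 2$ be an integer and $\omega_a=e^{2\pi i/a}$. Let $\varphi_0$ be the 1-periodic function on $\mathbb R$ with $\varphi_0(x)=\omega_a^k$ for $x\in[\frac ka,\frac{k+1}a)$, $k=0,\dots,a-1$, and let $\varphi_n(x)=\varphi_0(a^nx)$. The generalized Walsh system of order $a$ is given by $\psi_0=1$ and $\psi_n=\prod_j\varphi_j^{\alpha_j}$, where $n=\sum_j\alpha_ja^j$, $0\le\alpha_j<a$, is the base-$a$ expansion of $n$. Put $T=[0,1]^2$. For a measurable $\mu:T\to(0,1]$, let $L^1_\mu(T)$ be the space of measurable functions $f:T\to\mathbb C$ with $\iint_T|f|\,\mu\,dx\,dy<\infty$. **Theorem 3.1.** There exist complex numbers $c_{n,k}$, $n,k\ge1$, with $\sum_{n,k=1}^\infty|c_{n,k}|^q<\infty$ for every $q>2$, such that for every $\varepsilon>0$ there is a measurable function $\mu:T\to(0,1]$ with $|\{(x,y)\in T:\mu(x,y)\ne1\}|<\varepsilon$ for which the series $\sum_{n,k=1}^\infty c_{n,k}\psi_n(x)\psi_k(y)$ is universal in $L^1_\mu(T)$ concerning subseries, with respect to both rectangular and spherical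 partial sums: for every $f\in L^1_\mu(T)$ there is an infinite set $S$ of pairs of positive integers such that $$\lim_{N,M\to\infty}\iint_T\Big|\sum_{\substack{1\le n\le N,\ 1\le k\le M\\(n,k)\in S}}c_{n,k}\psi_n(x)\psi_k(y)-f(x,y)\Big|\,\mu(x,y)\,dx\,dy=0$$ (where $N$ and $M$ tend to infinity independently) and $$\lim_{R\to\infty}\iint_T\Big|\sum_{\substack{n^2+k^2\le R^2\\(n,k)\in S}}c_{n,k}\psi_n(x)\psi_k(y)-f(x,y)\Big|\,\mu(x,y)\,dx\,dy=0 .$$ -/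

import Mathlib

open MeasureTheory Filter Topology

noncomputable section

namespace GenWalsh

/-- The unit square `T = [0,1]²`. -/
def unitSquare : Set (ℝ × ℝ) := Set.Icc 0 1 ×ˢ Set.Icc 0 1

/-- The primitive root of unity `ω_a = exp (2πi / a)`. -/
def omega (a : ℕ) : ℂ := Complex.exp (2 * Real.pi * Complex.I / a)

/-- The 1-periodic function `φ_0` of order `a`: it equals `ω_a ^ k` on `[k/a, (k+1)/a)` for
`k = 0, …, a - 1`. -/
def rademacherZero (a : ℕ) (x : ℝ) : ℂ := omega a ^ ⌊(a : ℝ) * Int.fract x⌋₊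

/-- The generalized Rademacher system of order `a`: `φ_n(x) = φ_0(aⁿ x)`. -/
def rademacher (a n : ℕ) (x : ℝ) : ℂ := rademacherZero a ((a : ℝ) ^ n * x)

/-- The generalized Walsh system of order `a`: `ψ_n = ∏_j φ_j ^ α_j`, where `n = ∑_j α_j a^j` is
the base `a` expansion of `n`. The factors with `α_j = 0` are `1`, and `ψ_0 = 1`. -/
def walsh (a n : ℕ) (x : ℝ) : ℂ :=
  ∏ j ∈ Finset.range (Nat.digits a n).length, rademacher a j x ^ (Nat.digits a n).getD j 0

/-- The rectangular partial sum `∑_{k=1}^n ∑_{ν=1}^m c_{k,ν} ψ_k(x) ψ_ν(y)`. -/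
def rectSum (a : ℕ) (c : ℕ → ℕ → ℂ) (n m : ℕ) (p : ℝ × ℝ) : ℂ :=
  ∑ k ∈ Finset.Icc 1 n, ∑ ν ∈ Finset.Icc 1 m, c k ν * walsh a k p.1 * walsh a ν p.2

/-- The spherical partial sum `∑_{k,ν ≥ 1, k² + ν² ≤ R²} c_{k,ν} ψ_k(x) ψ_ν(y)`.
The bounds `k, ν ≤ |R|` follow from `k² + ν² ≤ R²`. -/
def sphericalSum (a : ℕ) (c : ℕ → ℕ → ℂ) (R : ℝ) (p : ℝ × ℝ) : ℂ :=
  ∑ k ∈ Finset.Icc 1 ⌊|R|⌋₊, ∑ ν ∈ Finset.Icc 1 ⌊|R|⌋₊,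
    if (k : ℝ) ^ 2 + (ν : ℝ) ^ 2 ≤ R ^ 2 then c k ν * walsh a k p.1 * walsh a ν p.2 else 0

open Classical in
/-- The coefficients of the subseries consisting of the terms with index in `S`. -/
def subCoeff (c : ℕ → ℕ → ℂ) (S : Set (ℕ × ℕ)) (k ν : ℕ) : ℂ :=
  if (k, ν) ∈ S then c k ν else 0

/-- The measure `μ(x,y) dx dy` on `[0,1]²`. -/
def weightedMeasure (μ : ℝ × ℝ → ℝ) : Measure (ℝ × ℝ) :=
  (volume.restrict unitSquare).withDensity fun p => ENNReal.ofReal (μ p)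

/-- The distance `∬_{[0,1]²} |g - f| μ dx dy` of `L¹_μ`, with values in `[0,∞]`. -/
def distL1 (μ : ℝ × ℝ → ℝ) (g f : ℝ × ℝ → ℂ) : ENNReal :=
  ∫⁻ p, ‖g p - f p‖ₑ ∂weightedMeasure μ

/-- The double series `∑_{n,k ≥ 1} c_{n,k} ψ_n(x) ψ_k(y)` is universal in `L¹_μ([0,1]²)` concerning
subseries: for each `f` in `L¹_μ` one infinite set `S` of positive indices gives a subseries that
converges to `f` in `L¹_μ` both by rectangles (the two bounds tend to infinity independently) and
by spheres. -/
def UniversalConcerningSubseries (a : ℕ) (c : ℕ → ℕ → ℂ) (μ : ℝ × ℝ → ℝ) : Prop :=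
  ∀ f : ℝ × ℝ → ℂ, Integrable f (weightedMeasure μ) →
    ∃ S : Set (ℕ × ℕ), S.Infinite ∧ (∀ p ∈ S, 1 ≤ p.1 ∧ 1 ≤ p.2) ∧
      Tendsto (fun N : ℕ × ℕ => distL1 μ (rectSum a (subCoeff c S) N.1 N.2) f) atTop (𝓝 0) ∧
      Tendsto (fun R : ℝ => distL1 μ (sphericalSum a (subCoeff c S) R) f) atTop (𝓝 0)

end GenWalsh

end

/-!
The truncations defining rectangular and spherical partial sums are both by *lower sets* of indices
`(n, k)`, so both kinds of convergence are treated at once. If double Walsh polynomials have their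
spectra in squares `[N_s, N_{s+1})²` placed one after another along the diagonal, a lower set
contains all squares up to some place and misses all squares after it, hence cuts at most one of the
polynomials (`exists_cut`).

*Local polynomials.* Let `Δ` be a cell of rank `m` of the `a`-adic partition. The function
`1 - a ^ r 1_{[0, a ^ (-r))}` has mean zero, so after compression by a factor `a ^ L`, `L ≥ m`, and
multiplication by the indicator of an interval of rank `m`, it is a Walsh polynomial with spectrum
in `[a ^ L, a ^ (L + r))` which equals the indicator off a set of relative measure `a ^ (-r)`. The
product of two of these is a double polynomial which equals `1_Δ` off a set of relative measure
`2 a ^ (-r)` and vanishes outside `Δ` (`exists_polynomial_cell_prod`).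

*Blocks.* Given a step function `F`, the cells are refined and the local polynomials are added up,
with spectra in consecutive squares (`exists_isBlock`). The sum equals `F` off a set `B` of measure
`2 a ^ (-r)`. Parseval's identity bounds the sum of the squares of all coefficients by a constant
depending on `F` and `r`, while each local polynomial has an `L²` norm of the order of the side of
a cell. Hence the sum of the powers `2 + δ` of the coefficients is as small as desired. By Bessel's
inequality and the disjointness of the cells, every truncation by a lower set is bounded off `B` by
`|F|` plus a function that is small in `L¹`.

*The series and the weight.* The series is the sum of blocks, `s = 0, 1, …`, for a sequence of step
functions `F_s` in which a dense family recurs (`exists_blocks`). The exceptional sets `B_s` have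
summable measures, so there is a weight that is `1` off a small set and makes the later `B_s`
negligible, even against the largest possible value of their blocks (`exists_weight`).

*Subseries.* For `f` in the weighted space, choose blocks greedily: the next one represents a step
function close to the difference between `f` and the sum of the blocks already chosen. The chosen
blocks add up to `f`, and the one block that a lower set may cut is small, since its step function
is (`exists_subseries`).
-/

namespace GenWalsh

open ComplexConjugate

/-! ### Roots of unity and digits -/

lemma omega_isPrimitiveRoot {a : ℕ} (ha : 2 ≤ a) : IsPrimitiveRoot (omega a) a :=
  Complex.isPrimitiveRoot_exp a (by omega)

lemma norm_omega {a : ℕ} (ha : 2 ≤ a) : ‖omega a‖ = 1 :=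
  (omega_isPrimitiveRoot ha).norm'_eq_one (by omega)

lemma mul_conj_eq_one {z : ℂ} (hz : ‖z‖ = 1) : z * conj z = 1 := by
  rw [Complex.mul_conj, Complex.normSq_eq_norm_sq, hz]; simp

lemma sum_omega_pow {a : ℕ} (ha : 2 ≤ a) {i j : ℕ} (hi : i < a) (hj : j < a) :
    ∑ k ∈ Finset.range a, (omega a ^ i * conj (omega a ^ j)) ^ k
      = if i = j then (a : ℂ) else 0 := by
  have hw := norm_omega ha
  have hnj : ‖omega a ^ j‖ = 1 := by rw [norm_pow, hw, one_pow]
  set z := omega a ^ i * conj (omega a ^ j) with hz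
  split_ifs with h
  · have : z = 1 := by rw [hz, h, mul_conj_eq_one hnj]
    simp [this]
  · have h1 : z ≠ 1 := by
      intro h1
      apply h
      apply (omega_isPrimitiveRoot ha).pow_inj hi hj
      calc omega a ^ i = omega a ^ i * (omega a ^ j * conj (omega a ^ j)) := by
            rw [mul_conj_eq_one hnj, mul_one]
        _ = omega a ^ j * z := by rw [hz]; ring
        _ = omega a ^ j := by rw [h1, mul_one]
    have h2 : z ^ a = 1 := by
      have h3 := (omega_isPrimitiveRoot ha).pow_eq_one
      rw [hz, mul_pow, ← map_pow, ← pow_mul, ← pow_mul, mul_comm i, mul_comm j, pow_mul,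
        pow_mul, h3]
      simp
    have h3 := mul_geom_sum z a
    rw [h2, sub_self] at h3
    exact (mul_eq_zero.1 h3).resolve_left (sub_ne_zero.2 h1)

/-- The index `i` of the `a`-adic interval `[i / a ^ m, (i + 1) / a ^ m)` of rank `m` containing the
fractional part of `x`. -/
noncomputable def cell (a m : ℕ) (x : ℝ) : ℕ := ⌊(a : ℝ) ^ m * Int.fract x⌋₊

lemma cell_lt {a : ℕ} (ha : 2 ≤ a) (m : ℕ) (x : ℝ) : cell a m x < a ^ m := by
  have hp : (0 : ℝ) < (a : ℝ) ^ m := by positivity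
  rw [cell, Nat.floor_lt (mul_nonneg hp.le (Int.fract_nonneg x))]
  push_cast
  nlinarith [Int.fract_lt_one x]

lemma measurable_cell (a m : ℕ) : Measurable (cell a m) :=
  Nat.measurable_floor.comp (measurable_const.mul measurable_fract)

lemma cell_zero (a : ℕ) (x : ℝ) : cell a 0 x = 0 := by
  simp [cell, Nat.floor_eq_zero, Int.fract_lt_one]

lemma rademacherZero_eq (a : ℕ) (x : ℝ) : rademacherZero a x = omega a ^ cell a 1 x := by
  simp [rademacherZero, cell]

/-- The digits of `x` are its first digit followed by the digits of `a x`. -/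
lemma cell_succ {a : ℕ} (ha : 2 ≤ a) (m : ℕ) (x : ℝ) :
    cell a (m + 1) x = cell a m (a * x) + a ^ m * cell a 1 x := by
  have h1 : ((⌊(a : ℝ) * Int.fract x⌋₊ : ℕ) : ℝ) + Int.fract ((a : ℝ) * x) = a * Int.fract x := by
    have h0 : 0 ≤ (a : ℝ) * Int.fract x := mul_nonneg (by positivity) (Int.fract_nonneg x)
    have : Int.fract ((a : ℝ) * x) = Int.fract ((a : ℝ) * Int.fract x) := by
      rw [Int.fract_eq_fract]
      refine ⟨a * ⌊x⌋, ?_⟩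
      push_cast
      rw [Int.fract]; ring
    rw [this, natCast_floor_eq_intCast_floor h0, Int.floor_add_fract]
  have h2 : (a : ℝ) ^ (m + 1) * Int.fract x
      = (a : ℝ) ^ m * Int.fract ((a : ℝ) * x) + ((a ^ m * cell a 1 x : ℕ) : ℝ) := by
    rw [pow_succ, mul_assoc, ← h1, cell]
    push_cast
    rw [pow_one]; ring
  rw [cell, h2, Nat.floor_add_natCast (mul_nonneg (by positivity) (Int.fract_nonneg _))]
  rfl

lemma cell_succ_eq_iff {a : ℕ} (ha : 2 ≤ a) (m : ℕ) (x t : ℝ) :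
    cell a (m + 1) x = cell a (m + 1) t ↔
      cell a 1 x = cell a 1 t ∧ cell a m (a * x) = cell a m (a * t) := by
  rw [cell_succ ha m x, cell_succ ha m t]
  have hx := cell_lt ha m (a * x)
  have ht := cell_lt ha m (a * t)
  have hp : 0 < a ^ m := by positivity
  constructor
  · intro h
    have h1 := congrArg (· / a ^ m) h
    have h2 := congrArg (· % a ^ m) h
    simp only [Nat.add_mul_div_left _ _ hp, Nat.add_mul_mod_self_left, Nat.div_eq_of_lt hx,
      Nat.div_eq_of_lt ht, Nat.mod_eq_of_lt hx, Nat.mod_eq_of_lt ht, zero_add] at h1 h2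
    exact ⟨h1, h2⟩
  · rintro ⟨h1, h2⟩
    rw [h1, h2]

/-- Passing to a coarser rank drops the last digits. -/
lemma cell_eq_cell_add_div {a : ℕ} (ha : 2 ≤ a) (m l : ℕ) (x : ℝ) :
    cell a m x = cell a (m + l) x / a ^ l := by
  have : (a : ℝ) ≠ 0 := by positivity
  rw [cell, cell, ← Nat.floor_div_natCast]
  congr 1
  push_cast
  field_simp
  ring

lemma cell_natCast_div {a : ℕ} (ha : 2 ≤ a) (m : ℕ) {i : ℕ} (hi : i < a ^ m) :
    cell a m (i / (a : ℝ) ^ m) = i := by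
  have h0 : (0 : ℝ) < (a : ℝ) ^ m := by positivity
  have h1 : (i : ℝ) / (a : ℝ) ^ m < 1 := by
    rw [div_lt_one h0]; exact_mod_cast hi
  rw [cell, Int.fract_eq_self.2 ⟨by positivity, h1⟩, mul_div_cancel₀ _ h0.ne', Nat.floor_natCast]

/-! ### The Walsh system on the line -/

lemma rademacher_succ (a j : ℕ) (x : ℝ) : rademacher a (j + 1) x = rademacher a j (a * x) := by
  rw [rademacher, rademacher, pow_succ, mul_assoc]

lemma walsh_zero (a : ℕ) (x : ℝ) : walsh a 0 x = 1 := by simp [walsh]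

/-- Splitting off the last digit of the index. -/
lemma walsh_add_mul {a : ℕ} (ha : 2 ≤ a) {r : ℕ} (hr : r < a) (q : ℕ) (x : ℝ) :
    walsh a (r + a * q) x = rademacherZero a x ^ r * walsh a q (a * x) := by
  by_cases h : r ≠ 0 ∨ q ≠ 0
  · simp only [walsh]
    rw [Nat.digits_add a (by omega) r q hr h, List.length_cons, Finset.prod_range_succ', mul_comm]
    congr 1
    · simp [rademacher]
    · refine Finset.prod_congr rfl fun j _ => ?_
      rw [rademacher_succ, List.getD_cons_succ]
  · push Not at h
    simp [h.1, h.2, walsh_zero]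

/-- Splitting off the last `L` digits of the index. -/
lemma walsh_add_pow_mul {a : ℕ} (ha : 2 ≤ a) (L : ℕ) {n : ℕ} (hn : n < a ^ L) (k : ℕ) (x : ℝ) :
    walsh a (n + a ^ L * k) x = walsh a n x * walsh a k ((a : ℝ) ^ L * x) := by
  induction L generalizing n x with
  | zero =>
    have : n = 0 := by simpa using hn
    simp [this, walsh_zero]
  | succ L ih =>
    have hq : n / a < a ^ L := Nat.div_lt_of_lt_mul (by rwa [pow_succ'] at hn)
    have hr : n % a < a := Nat.mod_lt _ (by omega)
    have h1 : n + a ^ (L + 1) * k = n % a + a * (n / a + a ^ L * k) := by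
      conv_lhs => rw [← Nat.mod_add_div n a]
      ring
    rw [h1, walsh_add_mul ha hr, ih hq]
    conv_rhs => rw [← Nat.mod_add_div n a, walsh_add_mul ha hr]
    rw [pow_succ]
    ring_nf

lemma norm_rademacherZero {a : ℕ} (ha : 2 ≤ a) (x : ℝ) : ‖rademacherZero a x‖ = 1 := by
  rw [rademacherZero, norm_pow, norm_omega ha, one_pow]

lemma norm_walsh {a : ℕ} (ha : 2 ≤ a) (n : ℕ) (x : ℝ) : ‖walsh a n x‖ = 1 := by
  rw [walsh, norm_prod]
  refine Finset.prod_eq_one fun j _ => ?_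
  rw [norm_pow, rademacher, norm_rademacherZero ha, one_pow]

lemma measurable_rademacherZero (a : ℕ) : Measurable (rademacherZero a) := by
  have : rademacherZero a = (fun k : ℕ => omega a ^ k) ∘ cell a 1 :=
    funext fun x => rademacherZero_eq a x
  rw [this]
  exact (measurable_of_countable _).comp (measurable_cell a 1)

lemma measurable_walsh (a n : ℕ) : Measurable (walsh a n) := by
  have : walsh a n = fun x => ∏ j ∈ Finset.range (Nat.digits a n).length,
    rademacher a j x ^ (Nat.digits a n).getD j 0 := rfl
  rw [this]
  refine Finset.measurable_prod _ fun j _ => Measurable.pow_const ?_ _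
  exact (measurable_rademacherZero a).comp (measurable_const.mul measurable_id)

lemma walsh_periodic (a n : ℕ) : Function.Periodic (walsh a n) 1 := by
  intro x
  simp only [walsh]
  refine Finset.prod_congr rfl fun j _ => ?_
  have h : (a : ℝ) ^ j * (x + 1) = (a : ℝ) ^ j * x + ((a ^ j : ℕ) : ℝ) := by push_cast; ring
  rw [rademacher, rademacher, rademacherZero, rademacherZero, h, Int.fract_add_natCast]

lemma sum_range_mul_eq {M : Type*} [AddCommMonoid M] (a b : ℕ) (f : ℕ → M) :
    ∑ n ∈ Finset.range (a * b), f n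
      = ∑ q ∈ Finset.range b, ∑ r ∈ Finset.range a, f (r + a * q) := by
  induction b with
  | zero => simp
  | succ b ih =>
    rw [mul_add, mul_one, Finset.sum_range_add, ih, Finset.sum_range_succ]
    simp only [add_comm]

/-- The Dirichlet kernel of order `a ^ m` is a multiple of the indicator of the `a`-adic intervals
of rank `m`. -/
lemma sum_walsh_mul_conj {a : ℕ} (ha : 2 ≤ a) (m : ℕ) (x t : ℝ) :
    ∑ n ∈ Finset.range (a ^ m), walsh a n x * conj (walsh a n t)
      = if cell a m x = cell a m t then (a : ℂ) ^ m else 0 := by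
  induction m generalizing x t with
  | zero => simp [cell_zero, walsh_zero]
  | succ m ih =>
    have h1 : ∀ q, ∑ r ∈ Finset.range a, walsh a (r + a * q) x * conj (walsh a (r + a * q) t)
        = (if cell a 1 x = cell a 1 t then (a : ℂ) else 0)
          * (walsh a q (a * x) * conj (walsh a q (a * t))) := by
      intro q
      have hc : ∀ y, cell a 1 y < a := fun y => by simpa using cell_lt ha 1 y
      rw [← sum_omega_pow ha (hc x) (hc t), Finset.sum_mul]
      refine Finset.sum_congr rfl fun r hr => ?_
      rw [walsh_add_mul ha (Finset.mem_range.1 hr), walsh_add_mul ha (Finset.mem_range.1 hr),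
        rademacherZero_eq, rademacherZero_eq, map_mul, map_pow, mul_pow]
      ring
    rw [pow_succ', sum_range_mul_eq]
    simp_rw [h1]
    rw [← Finset.mul_sum, ih]
    rw [if_congr (cell_succ_eq_iff ha m x t) rfl rfl, ite_and]
    split_ifs <;> ring

lemma integrable_of_bound {F : ℝ → ℂ} (hF : Measurable F) (C : ℝ) (hC : ∀ x, ‖F x‖ ≤ C) (u v : ℝ) :
    IntervalIntegrable F volume u v := by
  rw [intervalIntegrable_iff]
  exact Measure.integrableOn_of_bounded (M := C) (by simp) hF.aestronglyMeasurable
    (Eventually.of_forall hC)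

/-- Integrating a function of the first digit of `x` times a function of the remaining digits. -/
lemma integral_digit_mul {a : ℕ} (ha : 2 ≤ a) (g : ℕ → ℂ) {F : ℝ → ℂ} (hF : Measurable F) (C : ℝ)
    (hC : ∀ x, ‖F x‖ ≤ C) (hp : Function.Periodic F 1) :
    ∫ x in (0 : ℝ)..1, g (cell a 1 x) * F (a * x)
      = (∑ k ∈ Finset.range a, g k) / a * ∫ x in (0 : ℝ)..1, F x := by
  have ha0 : (0 : ℝ) < a := by positivity
  have hFa : Measurable fun x : ℝ => F (a * x) := hF.comp (measurable_const.mul measurable_id)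
  have hcongr : ∀ k ∈ Finset.range a, ∀ x ∈ Set.Ioo ((k : ℝ) / a) ((k + 1 : ℕ) / a),
      cell a 1 x = k := by
    intro k hk x hx
    have hk' : (k : ℝ) + 1 ≤ a := by exact_mod_cast Finset.mem_range.1 hk
    have h1 : (k : ℝ) < a * x := by have := hx.1; rw [div_lt_iff₀ ha0] at this; linarith
    have h2 : a * x < k + 1 := by
      have := hx.2; rw [lt_div_iff₀ ha0] at this; push_cast at this; linarith
    have hx0 : 0 ≤ x := le_trans (by positivity) hx.1.le
    have hx1 : x < 1 := by nlinarith
    rw [cell, Int.fract_eq_self.2 ⟨hx0, hx1⟩, pow_one, Nat.floor_eq_iff (by positivity)]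
    exact ⟨h1.le, h2⟩
  have hle : ∀ k : ℕ, (k : ℝ) / a ≤ ((k + 1 : ℕ) : ℝ) / a := fun k => by
    gcongr; simp
  have hcell : ∀ x, cell a 1 x < a := fun x => by simpa using cell_lt ha 1 x
  have hint : ∀ u v, IntervalIntegrable (fun x => g (cell a 1 x) * F (a * x)) volume u v := by
    refine integrable_of_bound (((measurable_of_countable g).comp (measurable_cell a 1)).mul hFa)
      ((∑ k ∈ Finset.range a, ‖g k‖) * C) fun x => ?_
    rw [norm_mul]
    gcongr
    · exact Finset.single_le_sum (f := fun k => ‖g k‖) (fun _ _ => norm_nonneg _)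
        (Finset.mem_range.2 (hcell x))
    · exact hC _
  have h := intervalIntegral.sum_integral_adjacent_intervals (a := fun k : ℕ => (k : ℝ) / a)
    (n := a) (fun k _ => hint (k / a) ((k + 1 : ℕ) / a))
  simp only [Nat.cast_zero, zero_div, div_self ha0.ne'] at h
  rw [← h, Finset.sum_div, Finset.sum_mul]
  refine Finset.sum_congr rfl fun k hk => ?_
  have h1 : ∫ x in ((k : ℝ) / a)..((k + 1 : ℕ) / a), g (cell a 1 x) * F (a * x)
      = ∫ x in ((k : ℝ) / a)..((k + 1 : ℕ) / a), g k * F (a * x) := by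
    rw [intervalIntegral.integral_of_le (hle k), intervalIntegral.integral_of_le (hle k),
      integral_Ioc_eq_integral_Ioo, integral_Ioc_eq_integral_Ioo]
    exact setIntegral_congr_fun measurableSet_Ioo fun x hx => by
      simp only [hcongr k hk x hx]
  rw [h1, intervalIntegral.integral_const_mul, intervalIntegral.integral_comp_mul_left _ ha0.ne',
    mul_div_cancel₀ _ ha0.ne', mul_div_cancel₀ _ ha0.ne']
  have h2 := hp.intervalIntegral_add_eq (k : ℝ) 0
  rw [zero_add] at h2
  push_cast
  rw [h2, Complex.real_smul]
  push_cast
  ring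

/-- The Walsh system is orthonormal on `[0,1]`. -/
lemma integral_walsh_mul_conj {a : ℕ} (ha : 2 ≤ a) (n m : ℕ) :
    ∫ x in (0 : ℝ)..1, walsh a n x * conj (walsh a m x) = if n = m then 1 else 0 := by
  induction h : n + m using Nat.strong_induction_on generalizing n m with
  | _ N ih =>
    by_cases h0 : n + m = 0
    · obtain ⟨rfl, rfl⟩ : n = 0 ∧ m = 0 := by omega
      simp [walsh_zero]
    · have hr : n % a < a := Nat.mod_lt _ (by omega)
      have hs : m % a < a := Nat.mod_lt _ (by omega)
      have hlt : n / a + m / a < N := by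
        have h1 : n / a ≤ n := Nat.div_le_self _ _
        have h2 : m / a ≤ m := Nat.div_le_self _ _
        rcases Nat.eq_zero_or_pos n with hn | hn
        · have := Nat.div_lt_self (show 0 < m by omega) (show 1 < a by omega)
          omega
        · have := Nat.div_lt_self hn (show 1 < a by omega)
          omega
      have hpt : ∀ x, walsh a n x * conj (walsh a m x)
          = (fun k => (omega a ^ (n % a) * conj (omega a ^ (m % a))) ^ k) (cell a 1 x)
            * (fun y => walsh a (n / a) y * conj (walsh a (m / a) y)) (a * x) := by
        intro x
        conv_lhs => rw [← Nat.mod_add_div n a, ← Nat.mod_add_div m a, walsh_add_mul ha hr,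
          walsh_add_mul ha hs, rademacherZero_eq]
        simp only [map_mul, map_pow, mul_pow, ← pow_mul, mul_comm (cell a 1 x)]
        ring
      simp_rw [hpt]
      rw [integral_digit_mul ha (fun k => (omega a ^ (n % a) * conj (omega a ^ (m % a))) ^ k)
        (F := fun y => walsh a (n / a) y * conj (walsh a (m / a) y)) _ 1 _ _,
        ih _ hlt _ _ rfl, sum_omega_pow ha hr hs]
      · have ha0 : (a : ℂ) ≠ 0 := by norm_cast; omega
        have hiff : n = m ↔ n % a = m % a ∧ n / a = m / a := by
          refine ⟨fun h => by simp [h], fun ⟨h1, h2⟩ => ?_⟩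
          rw [← Nat.mod_add_div n a, ← Nat.mod_add_div m a, h1, h2]
        simp only [hiff]
        by_cases hA : n % a = m % a <;> by_cases hB : n / a = m / a <;> simp [hA, hB, ha0]
      · exact (measurable_walsh a _).mul
          (Complex.continuous_conj.measurable.comp (measurable_walsh a _))
      · intro x; simp [norm_walsh ha]
      · intro x; simp only [walsh_periodic a _ x]

/-! ### Localised one-dimensional polynomials -/

lemma walsh_at_zero (a n : ℕ) : walsh a n 0 = 1 := by
  simp [walsh, rademacher, rademacherZero]

lemma indicator_cell_zero {a : ℕ} (ha : 2 ≤ a) (r : ℕ) (x : ℝ) :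
    (if cell a r x = 0 then (a : ℂ) ^ r else 0) = ∑ k ∈ Finset.range (a ^ r), walsh a k x := by
  have h := sum_walsh_mul_conj ha r x 0
  have h0 : cell a r 0 = 0 := by simp [cell]
  rw [h0] at h
  rw [← h]
  simp [walsh_at_zero]

lemma indicator_cell {a : ℕ} (ha : 2 ≤ a) (m : ℕ) {i : ℕ} (hi : i < a ^ m) (x : ℝ) :
    (if cell a m x = i then (1 : ℂ) else 0) = ∑ n ∈ Finset.range (a ^ m),
      ((a : ℂ) ^ m)⁻¹ * conj (walsh a n (i / (a : ℝ) ^ m)) * walsh a n x := by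
  have h := sum_walsh_mul_conj ha m x (i / (a : ℝ) ^ m)
  rw [cell_natCast_div ha m hi] at h
  have ha0 : (a : ℂ) ≠ 0 := by norm_cast; omega
  calc (if cell a m x = i then (1 : ℂ) else 0)
      = ((a : ℂ) ^ m)⁻¹ * (if cell a m x = i then (a : ℂ) ^ m else 0) := by
        split_ifs <;> simp [ha0]
    _ = _ := by
        rw [← h, Finset.mul_sum]
        exact Finset.sum_congr rfl fun n _ => by ring

lemma integral_walsh {a : ℕ} (ha : 2 ≤ a) (n : ℕ) :
    ∫ x in (0 : ℝ)..1, walsh a n x = if n = 0 then 1 else 0 := by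
  simpa [walsh_zero] using integral_walsh_mul_conj ha n 0

/-- The set of points of an `a`-adic interval of rank `m` whose digits at the places
`L + 1, …, L + r` vanish has the measure predicted by independence of the digits. -/
lemma volume_cell_inter {a : ℕ} (ha : 2 ≤ a) {m L : ℕ} (hmL : m ≤ L) (r : ℕ) {i : ℕ}
    (hi : i < a ^ m) :
    volume ({x | cell a m x = i ∧ cell a r ((a : ℝ) ^ L * x) = 0} ∩ Set.Icc 0 1)
      = ENNReal.ofReal (((a : ℝ) ^ m)⁻¹ * ((a : ℝ) ^ r)⁻¹) := by
  have ha0 : (a : ℂ) ≠ 0 := by norm_cast; omega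
  have hmeas : MeasurableSet {x | cell a m x = i ∧ cell a r ((a : ℝ) ^ L * x) = 0} :=
    ((measurable_cell a m) (measurableSet_singleton i)).inter
      (((measurable_cell a r).comp (measurable_const.mul measurable_id))
        (measurableSet_singleton 0))
  set S := {x | cell a m x = i ∧ cell a r ((a : ℝ) ^ L * x) = 0} with hS
  have h1 : ∀ x, S.indicator (fun _ => (1 : ℂ)) x = ∑ n ∈ Finset.range (a ^ m),
      ∑ k ∈ Finset.range (a ^ r), ((a : ℂ) ^ m)⁻¹ * conj (walsh a n (i / (a : ℝ) ^ m)) *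
        ((a : ℂ) ^ r)⁻¹ * walsh a (n + a ^ L * k) x := by
    intro x
    have : S.indicator (fun _ => (1 : ℂ)) x = (if cell a m x = i then (1 : ℂ) else 0)
        * (((a : ℂ) ^ r)⁻¹ * (if cell a r ((a : ℝ) ^ L * x) = 0 then (a : ℂ) ^ r else 0)) := by
      by_cases hA : cell a m x = i <;> by_cases hB : cell a r ((a : ℝ) ^ L * x) = 0 <;>
        simp [hS, Set.indicator, hA, hB, ha0]
    rw [this, indicator_cell ha m hi, indicator_cell_zero ha, Finset.mul_sum, Finset.sum_mul_sum]
    refine Finset.sum_congr rfl fun n hn => Finset.sum_congr rfl fun k _ => ?_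
    rw [walsh_add_pow_mul ha L
      ((Finset.mem_range.1 hn).trans_le (Nat.pow_le_pow_right (by omega) hmL))]
    ring
  have hint : ∀ n, IntervalIntegrable (walsh a n) volume 0 1 := fun n =>
    integrable_of_bound (measurable_walsh a n) 1 (fun x => (norm_walsh ha n x).le) 0 1
  have h2 : ∫ x in (0 : ℝ)..1, S.indicator (fun _ => (1 : ℂ)) x
      = ((a : ℂ) ^ m)⁻¹ * ((a : ℂ) ^ r)⁻¹ := by
    simp_rw [h1]
    rw [intervalIntegral.integral_finsetSum]
    · have : ∀ n ∈ Finset.range (a ^ m), ∫ x in (0 : ℝ)..1, ∑ k ∈ Finset.range (a ^ r),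
          ((a : ℂ) ^ m)⁻¹ * conj (walsh a n (i / (a : ℝ) ^ m)) * ((a : ℂ) ^ r)⁻¹ *
            walsh a (n + a ^ L * k) x
          = if n = 0 then ((a : ℂ) ^ m)⁻¹ * ((a : ℂ) ^ r)⁻¹ else 0 := by
        intro n _
        rw [intervalIntegral.integral_finsetSum fun k _ => (hint _).const_mul _]
        simp_rw [intervalIntegral.integral_const_mul, integral_walsh ha]
        have haL : a ≠ 0 := by omega
        by_cases hn : n = 0
        · subst hn
          simp [walsh_zero, haL, Nat.pos_of_ne_zero haL]
        · simp [hn]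
      rw [Finset.sum_congr rfl this]
      simp [show 0 < a by omega]
    · intro n _
      have := IntervalIntegrable.sum (Finset.range (a ^ r)) fun k _ =>
        (hint (n + a ^ L * k)).const_mul
          (((a : ℂ) ^ m)⁻¹ * conj (walsh a n (i / (a : ℝ) ^ m)) * ((a : ℂ) ^ r)⁻¹)
      rwa [Finset.sum_fn] at this
  rw [intervalIntegral.integral_of_le zero_le_one, ← integral_Icc_eq_integral_Ioc,
    integral_indicator hmeas, integral_const] at h2
  simp only [measureReal_restrict_apply_univ, Complex.real_smul, mul_one,
    measureReal_restrict_apply hmeas] at h2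
  have h3 : (volume : Measure ℝ).real (S ∩ Set.Icc 0 1) = ((a : ℝ) ^ m)⁻¹ * ((a : ℝ) ^ r)⁻¹ := by
    apply Complex.ofReal_injective
    rw [h2]
    push_cast
    rfl
  rw [← h3, ofReal_measureReal (measure_ne_top_of_subset Set.inter_subset_right (by simp))]

lemma volume_cell {a : ℕ} (ha : 2 ≤ a) (m : ℕ) {i : ℕ} (hi : i < a ^ m) :
    volume ({x | cell a m x = i} ∩ Set.Icc 0 1) = ENNReal.ofReal (((a : ℝ) ^ m)⁻¹) := by
  have h := volume_cell_inter ha (le_refl m) 0 hi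
  simpa [cell_zero] using h

/-- A Walsh polynomial with high frequencies that equals the indicator of an `a`-adic interval off a
small set: the mean zero function `1 - a ^ r 1_{[0, a ^ (-r))}` is compressed by the factor `a ^ L`
and multiplied by the indicator. -/
lemma exists_polynomial_cell {a : ℕ} (ha : 2 ≤ a) {m L : ℕ} (hmL : m ≤ L) (r : ℕ) {i : ℕ}
    (hi : i < a ^ m) :
    ∃ b : ℕ →₀ ℂ, (∀ n, b n ≠ 0 → n ∈ Set.Ico (a ^ L) (a ^ (L + r))) ∧
      ∀ x, Finsupp.linearCombination ℂ (fun n => walsh a n x) b = if cell a m x = i then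
        1 - (if cell a r ((a : ℝ) ^ L * x) = 0 then (a : ℂ) ^ r else 0) else 0 := by
  refine ⟨∑ n ∈ Finset.range (a ^ m), ∑ k ∈ Finset.Ico 1 (a ^ r), Finsupp.single (n + a ^ L * k)
    (-(((a : ℂ) ^ m)⁻¹ * conj (walsh a n (i / (a : ℝ) ^ m)))), ?_, ?_⟩
  · intro N hN
    rw [Finsupp.finsetSum_apply] at hN
    obtain ⟨n, hn, hN⟩ := Finset.exists_ne_zero_of_sum_ne_zero hN
    rw [Finsupp.finsetSum_apply] at hN
    obtain ⟨k, hk, hN⟩ := Finset.exists_ne_zero_of_sum_ne_zero hN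
    have hN' : n + a ^ L * k = N := by
      by_contra h
      exact hN (Finsupp.single_eq_of_ne' h)
    rw [Finset.mem_Ico] at hk
    have hn' : n < a ^ L := (Finset.mem_range.1 hn).trans_le (Nat.pow_le_pow_right (by omega) hmL)
    rw [← hN', pow_add]
    constructor
    · nlinarith [Nat.mul_le_mul_left (a ^ L) hk.1]
    · have := Nat.mul_le_mul_left (a ^ L) (Nat.succ_le_of_lt hk.2)
      rw [Nat.mul_succ] at this
      omega
  · intro x
    have hr : 0 < a ^ r := by positivity
    have h1 : ∑ k ∈ Finset.Ico 1 (a ^ r), walsh a k ((a : ℝ) ^ L * x)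
        = (if cell a r ((a : ℝ) ^ L * x) = 0 then (a : ℂ) ^ r else 0) - 1 := by
      rw [indicator_cell_zero ha, Finset.range_eq_Ico, Finset.sum_eq_sum_Ico_succ_bot hr,
        walsh_zero]
      ring
    have h2 : (if cell a m x = i then
        1 - (if cell a r ((a : ℝ) ^ L * x) = 0 then (a : ℂ) ^ r else 0) else 0)
        = (if cell a m x = i then (1 : ℂ) else 0) *
          -∑ k ∈ Finset.Ico 1 (a ^ r), walsh a k ((a : ℝ) ^ L * x) := by
      rw [h1]; split_ifs <;> ring
    rw [h2, indicator_cell ha m hi, mul_neg, Finset.sum_mul_sum, map_sum, ← Finset.sum_neg_distrib]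
    refine Finset.sum_congr rfl fun n hn => ?_
    rw [map_sum, ← Finset.sum_neg_distrib]
    refine Finset.sum_congr rfl fun k _ => ?_
    rw [Finsupp.linearCombination_single, walsh_add_pow_mul ha L
      ((Finset.mem_range.1 hn).trans_le (Nat.pow_le_pow_right (by omega) hmL)), smul_eq_mul]
    ring

/-! ### Truncated double Walsh polynomials -/

/-- The element `ψ_n(x) ψ_k(y)` of the double system, as a function of the index `(n, k)`. -/
noncomputable def walsh2 (a : ℕ) (p : ℝ × ℝ) (n : ℕ × ℕ) : ℂ := walsh a n.1 p.1 * walsh a n.2 p.2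

/-- The part over the index set `D` of the double Walsh polynomial with coefficients `c`. -/
noncomputable def partialSum (a : ℕ) (D : Set (ℕ × ℕ)) (c : ℕ × ℕ →₀ ℂ) (p : ℝ × ℝ) : ℂ :=
  Finsupp.linearCombination ℂ (D.indicator (walsh2 a p)) c

/-- The square `[A, B)²` of indices. -/
def box (A B : ℕ) : Set (ℕ × ℕ) := Set.Ico A B ×ˢ Set.Ico A B

lemma norm_walsh2 {a : ℕ} (ha : 2 ≤ a) (p : ℝ × ℝ) (n : ℕ × ℕ) : ‖walsh2 a p n‖ = 1 := by
  rw [walsh2, norm_mul, norm_walsh ha, norm_walsh ha, one_mul]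

lemma measurable_walsh2 (a : ℕ) (n : ℕ × ℕ) : Measurable fun p => walsh2 a p n :=
  ((measurable_walsh a n.1).comp measurable_fst).mul ((measurable_walsh a n.2).comp measurable_snd)

open Classical in
lemma partialSum_eq_sum (a : ℕ) (D : Set (ℕ × ℕ)) (c : ℕ × ℕ →₀ ℂ) (p : ℝ × ℝ) :
    partialSum a D c p = ∑ n ∈ c.support with n ∈ D, c n * walsh2 a p n := by
  rw [partialSum, Finsupp.linearCombination_apply, Finsupp.sum, Finset.sum_filter]
  refine Finset.sum_congr rfl fun n _ => ?_
  by_cases h : n ∈ D <;> simp [h]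

lemma measurable_partialSum (a : ℕ) (D : Set (ℕ × ℕ)) (c : ℕ × ℕ →₀ ℂ) :
    Measurable (partialSum a D c) := by
  classical
  rw [funext fun p => partialSum_eq_sum a D c p]
  exact Finset.measurable_sum _ fun n _ => measurable_const.mul (measurable_walsh2 a n)

lemma norm_partialSum_le {a : ℕ} (ha : 2 ≤ a) (D : Set (ℕ × ℕ)) (c : ℕ × ℕ →₀ ℂ) (p : ℝ × ℝ) :
    ‖partialSum a D c p‖ ≤ ∑ n ∈ c.support, ‖c n‖ := by
  classical
  rw [partialSum_eq_sum]
  refine (norm_sum_le _ _).trans ?_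
  simp only [norm_mul, norm_walsh2 ha, mul_one]
  exact Finset.sum_le_sum_of_subset_of_nonneg (Finset.filter_subset _ _)
    fun _ _ _ => norm_nonneg _

lemma partialSum_of_subset {a : ℕ} {D : Set (ℕ × ℕ)} {c : ℕ × ℕ →₀ ℂ} (h : ↑c.support ⊆ D)
    (p : ℝ × ℝ) : partialSum a D c p = partialSum a Set.univ c p := by
  classical
  rw [partialSum_eq_sum, partialSum_eq_sum, Finset.filter_true_of_mem fun n hn => h hn]
  simp

lemma partialSum_of_disjoint {a : ℕ} {D : Set (ℕ × ℕ)} {c : ℕ × ℕ →₀ ℂ}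
    (h : Disjoint (↑c.support : Set (ℕ × ℕ)) D) (p : ℝ × ℝ) : partialSum a D c p = 0 := by
  classical
  rw [partialSum_eq_sum, Finset.filter_false_of_mem fun n hn hD =>
    Set.disjoint_left.1 h hn hD, Finset.sum_empty]

lemma partialSum_finset_sum {ι : Type*} (a : ℕ) (D : Set (ℕ × ℕ)) (s : Finset ι)
    (c : ι → ℕ × ℕ →₀ ℂ) (p : ℝ × ℝ) :
    partialSum a D (∑ j ∈ s, c j) p = ∑ j ∈ s, partialSum a D (c j) p := by
  simp only [partialSum, map_sum]

lemma restrict_unitSquare : (volume : Measure (ℝ × ℝ)).restrict unitSquare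
    = (volume.restrict (Set.Icc (0 : ℝ) 1)).prod (volume.restrict (Set.Icc (0 : ℝ) 1)) := by
  rw [unitSquare, Measure.prod_restrict, Measure.volume_eq_prod]

instance : IsProbabilityMeasure ((volume : Measure (ℝ × ℝ)).restrict unitSquare) := by
  constructor
  rw [Measure.restrict_apply_univ, unitSquare, Measure.volume_eq_prod, Measure.prod_prod]
  simp

lemma integral_walsh2_mul_conj {a : ℕ} (ha : 2 ≤ a) (n m : ℕ × ℕ) :
    ∫ p in unitSquare, walsh2 a p n * conj (walsh2 a p m) = if n = m then 1 else 0 := by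
  have h : ∀ p : ℝ × ℝ, walsh2 a p n * conj (walsh2 a p m)
      = (fun x => walsh a n.1 x * conj (walsh a m.1 x)) p.1
        * (fun y => walsh a n.2 y * conj (walsh a m.2 y)) p.2 := by
    intro p; simp only [walsh2, map_mul]; ring
  rw [integral_congr_ae (Eventually.of_forall h), restrict_unitSquare,
    integral_prod_mul (fun x => walsh a n.1 x * conj (walsh a m.1 x))
      (fun y => walsh a n.2 y * conj (walsh a m.2 y)), integral_Icc_eq_integral_Ioc,
    integral_Icc_eq_integral_Ioc, ← intervalIntegral.integral_of_le zero_le_one,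
    ← intervalIntegral.integral_of_le zero_le_one, integral_walsh_mul_conj ha,
    integral_walsh_mul_conj ha]
  by_cases h1 : n.1 = m.1 <;> by_cases h2 : n.2 = m.2 <;> simp [Prod.ext_iff, h1, h2]

lemma integrable_of_norm_le {ν : Measure (ℝ × ℝ)} [IsFiniteMeasure ν] {E : Type*}
    [NormedAddCommGroup E] [MeasurableSpace E] [BorelSpace E] [SecondCountableTopology E]
    {F : ℝ × ℝ → E} (hF : Measurable F) (C : ℝ) (hC : ∀ p, ‖F p‖ ≤ C) : Integrable F ν :=
  Integrable.of_bound hF.aestronglyMeasurable C (Eventually.of_forall hC)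

/-- Parseval's identity for double Walsh polynomials. -/
lemma integral_norm_sq_sum {a : ℕ} (ha : 2 ≤ a) (s : Finset (ℕ × ℕ)) (b : ℕ × ℕ → ℂ) :
    ∫ p in unitSquare, ‖∑ n ∈ s, b n * walsh2 a p n‖ ^ 2 = ∑ n ∈ s, ‖b n‖ ^ 2 := by
  have hz : ∀ z : ℂ, ((‖z‖ ^ 2 : ℝ) : ℂ) = z * conj z := fun z => by
    rw [Complex.mul_conj, Complex.normSq_eq_norm_sq]
  have hI : ∀ n m, Integrable (fun p => b n * conj (b m) * (walsh2 a p n * conj (walsh2 a p m)))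
      (volume.restrict unitSquare) := by
    intro n m
    refine (integrable_of_norm_le (C := 1) ((measurable_walsh2 a n).mul
      (Complex.continuous_conj.measurable.comp (measurable_walsh2 a m))) fun p => ?_).const_mul _
    simp [norm_walsh2 ha]
  apply Complex.ofReal_injective
  rw [← integral_complex_ofReal]
  simp_rw [hz, map_sum, Finset.sum_mul_sum]
  have : ∀ p n m, b n * walsh2 a p n * conj (b m * walsh2 a p m)
      = b n * conj (b m) * (walsh2 a p n * conj (walsh2 a p m)) := by
    intro p n m; rw [map_mul]; ring
  simp_rw [this]
  rw [integral_finsetSum _ fun n _ => integrable_finsetSum _ fun m _ => hI n m]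
  push_cast
  refine Finset.sum_congr rfl fun n hn => ?_
  rw [integral_finsetSum _ fun m _ => hI n m]
  simp_rw [integral_const_mul, integral_walsh2_mul_conj ha]
  have hz' := hz (b n)
  push_cast at hz'
  simp [hn, hz']

/-- Bessel's inequality bounds the `L¹` norm of every truncation by the `ℓ²` norm of the
coefficients. -/
lemma lintegral_partialSum_le {a : ℕ} (ha : 2 ≤ a) (D : Set (ℕ × ℕ)) (c : ℕ × ℕ →₀ ℂ) {η : ℝ}
    (hη : 0 < η) (h : ∑ n ∈ c.support, ‖c n‖ ^ 2 ≤ η ^ 2) :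
    ∫⁻ p in unitSquare, ‖partialSum a D c p‖ₑ ≤ ENNReal.ofReal η := by
  classical
  have hb := norm_partialSum_le ha D c
  have hm := measurable_partialSum a D c
  have hsq : ∫ p in unitSquare, ‖partialSum a D c p‖ ^ 2 ≤ η ^ 2 := by
    simp_rw [partialSum_eq_sum]
    rw [integral_norm_sq_sum ha]
    exact (Finset.sum_le_sum_of_subset_of_nonneg (Finset.filter_subset _ _)
      fun _ _ _ => by positivity).trans h
  have hi1 : Integrable (fun p => ‖partialSum a D c p‖) (volume.restrict unitSquare) :=
    (integrable_of_norm_le hm _ hb).norm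
  have hi2 : Integrable (fun p => ‖partialSum a D c p‖ ^ 2) (volume.restrict unitSquare) := by
    refine integrable_of_norm_le (hm.norm.pow_const 2) ((∑ n ∈ c.support, ‖c n‖) ^ 2) fun p => ?_
    rw [norm_pow, norm_norm]
    gcongr
    exact hb p
  have h1 : ∫ p in unitSquare, ‖partialSum a D c p‖ ≤ η := by
    -- integrate `t ≤ (η + t ^ 2 / η) / 2`
    have h2 : ∫ p in unitSquare, ‖partialSum a D c p‖
        ≤ ∫ p in unitSquare, (η / 2 + (2 * η)⁻¹ * ‖partialSum a D c p‖ ^ 2) := by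
      refine integral_mono hi1 ((integrable_const _).add (hi2.const_mul _)) fun p => ?_
      have : η / 2 + (2 * η)⁻¹ * ‖partialSum a D c p‖ ^ 2 - ‖partialSum a D c p‖
          = (2 * η)⁻¹ * (‖partialSum a D c p‖ - η) ^ 2 := by
        field_simp; ring
      have h3 : 0 ≤ (2 * η)⁻¹ * (‖partialSum a D c p‖ - η) ^ 2 := by positivity
      change ‖partialSum a D c p‖ ≤ η / 2 + (2 * η)⁻¹ * ‖partialSum a D c p‖ ^ 2
      linarith
    rw [integral_add (integrable_const _) (hi2.const_mul _), integral_const_mul, integral_const]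
      at h2
    simp only [probReal_univ, one_smul] at h2
    have h4 : (2 * η)⁻¹ * ∫ p in unitSquare, ‖partialSum a D c p‖ ^ 2 ≤ (2 * η)⁻¹ * η ^ 2 := by
      gcongr
    have h5 : (2 * η)⁻¹ * η ^ 2 = η / 2 := by field_simp
    linarith
  rw [← ofReal_integral_norm_eq_lintegral_enorm (integrable_of_norm_le hm _ hb)]
  exact ENNReal.ofReal_le_ofReal h1

/-! ### Polynomials adapted to one cell of the square -/

/-- For each cell `Δ` of rank `m` there is a double Walsh polynomial with spectrum in
`[a ^ L, a ^ (L + r))²` which equals `γ 1_Δ` off a set `B` of measure at most `2 a ^ (-r) |Δ|`. -/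
lemma exists_polynomial_cell_prod {a : ℕ} (ha : 2 ≤ a) {m L : ℕ} (hmL : m ≤ L) (r : ℕ) {i k : ℕ}
    (hi : i < a ^ m) (hk : k < a ^ m) (γ : ℂ) :
    ∃ (c : ℕ × ℕ →₀ ℂ) (B : Set (ℝ × ℝ)), ↑c.support ⊆ box (a ^ L) (a ^ (L + r)) ∧
      MeasurableSet B ∧
      volume (B ∩ unitSquare)
        ≤ ENNReal.ofReal (2 * ((a : ℝ) ^ m)⁻¹ * ((a : ℝ) ^ m)⁻¹ * ((a : ℝ) ^ r)⁻¹) ∧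
      ∑ n ∈ c.support, ‖c n‖ ^ 2 ≤ (‖γ‖ * (a : ℝ) ^ (2 * r) * ((a : ℝ) ^ m)⁻¹) ^ 2 ∧
      ∀ p ∉ B, partialSum a Set.univ c p
        = if cell a m p.1 = i ∧ cell a m p.2 = k then γ else 0 := by
  classical
  obtain ⟨b, hb, hbe⟩ := exists_polynomial_cell ha hmL r hi
  obtain ⟨d, hd, hde⟩ := exists_polynomial_cell ha hmL r hk
  have hsub : ∀ n : ℕ × ℕ, γ * b n.1 * d n.2 ≠ 0 → n ∈ b.support ×ˢ d.support := by
    intro n hn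
    rw [Finset.mem_product, Finsupp.mem_support_iff, Finsupp.mem_support_iff]
    exact ⟨right_ne_zero_of_mul (left_ne_zero_of_mul hn), right_ne_zero_of_mul hn⟩
  set c : ℕ × ℕ →₀ ℂ := Finsupp.onFinset (b.support ×ˢ d.support)
    (fun n => γ * b n.1 * d n.2) hsub with hc
  set g : ℝ → ℂ := fun x => 1 - (if cell a r ((a : ℝ) ^ L * x) = 0 then (a : ℂ) ^ r else 0) with hg
  have hval : ∀ p, partialSum a Set.univ c p
      = if cell a m p.1 = i ∧ cell a m p.2 = k then γ * g p.1 * g p.2 else 0 := by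
    intro p
    have h1 : partialSum a Set.univ c p
        = γ * Finsupp.linearCombination ℂ (fun n => walsh a n p.1) b
          * Finsupp.linearCombination ℂ (fun n => walsh a n p.2) d := by
      rw [partialSum, Set.indicator_univ, Finsupp.linearCombination_apply,
        Finsupp.sum_of_support_subset c Finsupp.support_onFinset_subset _ (by simp),
        Finset.sum_product, Finsupp.linearCombination_apply, Finsupp.linearCombination_apply,
        Finsupp.sum, Finsupp.sum, mul_assoc, Finset.sum_mul_sum, Finset.mul_sum]
      refine Finset.sum_congr rfl fun n _ => ?_
      rw [Finset.mul_sum]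
      refine Finset.sum_congr rfl fun l _ => ?_
      simp only [hc, Finsupp.onFinset_apply, walsh2, smul_eq_mul]
      ring
    rw [h1, hbe, hde, ite_and]
    split_ifs <;> simp [*]
  have hcellp : 0 < ((a : ℝ) ^ m)⁻¹ := by positivity
  have hcellm := measurable_cell a m
  set R : Set (ℝ × ℝ) := {p | cell a m p.1 = i ∧ cell a m p.2 = k} with hR
  have hRm : MeasurableSet R :=
    ((hcellm.comp measurable_fst) (measurableSet_singleton i)).inter
      ((hcellm.comp measurable_snd) (measurableSet_singleton k))
  have hS : MeasurableSet {x : ℝ | cell a r ((a : ℝ) ^ L * x) = 0} :=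
    ((measurable_cell a r).comp (measurable_const.mul measurable_id)) (measurableSet_singleton 0)
  refine ⟨c, R ∩ {p | cell a r ((a : ℝ) ^ L * p.1) = 0 ∨ cell a r ((a : ℝ) ^ L * p.2) = 0},
    ?_, ?_, ?_, ?_, ?_⟩
  · intro n hn
    have hn' := hsub n (Finsupp.mem_support_iff.1 hn)
    rw [Finset.mem_product, Finsupp.mem_support_iff, Finsupp.mem_support_iff] at hn'
    exact ⟨hb _ hn'.1, hd _ hn'.2⟩
  · exact hRm.inter ((measurable_fst hS).union (measurable_snd hS))
  · have hcover : R ∩ {p | cell a r ((a : ℝ) ^ L * p.1) = 0 ∨ cell a r ((a : ℝ) ^ L * p.2) = 0}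
        ∩ unitSquare ⊆
        ({x | cell a m x = i ∧ cell a r ((a : ℝ) ^ L * x) = 0} ∩ Set.Icc 0 1) ×ˢ
            ({x | cell a m x = k} ∩ Set.Icc 0 1) ∪
          ({x | cell a m x = i} ∩ Set.Icc 0 1) ×ˢ
            ({x | cell a m x = k ∧ cell a r ((a : ℝ) ^ L * x) = 0} ∩ Set.Icc 0 1) := by
      rintro p ⟨⟨⟨h1, h2⟩, h3 | h3⟩, h4, h5⟩
      · exact Or.inl ⟨⟨⟨h1, h3⟩, h4⟩, ⟨h2, h5⟩⟩
      · exact Or.inr ⟨⟨h1, h4⟩, ⟨⟨h2, h3⟩, h5⟩⟩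
    refine (measure_mono hcover).trans ((measure_union_le _ _).trans ?_)
    rw [Measure.volume_eq_prod, Measure.prod_prod, Measure.prod_prod, volume_cell ha m hi,
      volume_cell ha m hk, volume_cell_inter ha hmL r hi, volume_cell_inter ha hmL r hk,
      ← ENNReal.ofReal_mul (by positivity), ← ENNReal.ofReal_mul (by positivity),
      ← ENNReal.ofReal_add (by positivity) (by positivity)]
    apply ENNReal.ofReal_le_ofReal
    apply le_of_eq
    ring
  · have hgb : ∀ x, ‖g x‖ ≤ (a : ℝ) ^ r := by
      intro x
      have h1 : (1 : ℝ) ≤ (a : ℝ) ^ r := one_le_pow₀ (by exact_mod_cast (by omega : 1 ≤ a))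
      simp only [hg]
      split_ifs
      · have : (1 : ℂ) - (a : ℂ) ^ r = ((1 - (a : ℝ) ^ r : ℝ) : ℂ) := by push_cast; ring
        rw [this, Complex.norm_real, Real.norm_eq_abs, abs_le]
        constructor <;> linarith
      · simpa using h1
    have hpt : ∀ p, ‖partialSum a Set.univ c p‖ ^ 2
        ≤ R.indicator (fun _ => (‖γ‖ * (a : ℝ) ^ (2 * r)) ^ 2) p := by
      intro p
      rw [hval]
      by_cases h : cell a m p.1 = i ∧ cell a m p.2 = k
      · rw [if_pos h, Set.indicator_of_mem (show p ∈ R from h), norm_mul, norm_mul, mul_assoc,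
          two_mul, pow_add]
        gcongr
        · exact hgb _
        · exact hgb _
      · rw [if_neg h, Set.indicator_of_notMem (show p ∉ R from h)]
        simp
    have hRv : (volume.restrict unitSquare).real R = ((a : ℝ) ^ m)⁻¹ * ((a : ℝ) ^ m)⁻¹ := by
      have : R ∩ unitSquare = ({x | cell a m x = i} ∩ Set.Icc 0 1) ×ˢ
          ({x | cell a m x = k} ∩ Set.Icc 0 1) := by
        ext p
        simp only [hR, unitSquare, Set.mem_inter_iff, Set.mem_ofPred_eq, Set.mem_prod]
        tauto
      rw [measureReal_restrict_apply hRm, this, measureReal_def, Measure.volume_eq_prod,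
        Measure.prod_prod, volume_cell ha m hi, volume_cell ha m hk,
        ← ENNReal.ofReal_mul (by positivity), ENNReal.toReal_ofReal (by positivity)]
    have hparseval : ∑ n ∈ c.support, ‖c n‖ ^ 2
        = ∫ p in unitSquare, ‖partialSum a Set.univ c p‖ ^ 2 := by
      simp_rw [partialSum_eq_sum]
      rw [integral_norm_sq_sum ha]
      simp
    rw [hparseval]
    calc ∫ p in unitSquare, ‖partialSum a Set.univ c p‖ ^ 2
        ≤ ∫ p in unitSquare, R.indicator (fun _ => (‖γ‖ * (a : ℝ) ^ (2 * r)) ^ 2) p := by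
          refine integral_mono_of_nonneg (Eventually.of_forall fun p => by positivity)
            ((integrable_const _).indicator hRm) (Eventually.of_forall hpt)
      _ = (‖γ‖ * (a : ℝ) ^ (2 * r) * ((a : ℝ) ^ m)⁻¹) ^ 2 := by
          rw [integral_indicator hRm, integral_const, measureReal_restrict_apply_univ, hRv,
            smul_eq_mul]
          ring
  · intro p hp
    rw [hval]
    by_cases h : cell a m p.1 = i ∧ cell a m p.2 = k
    · have h' : ¬ (cell a r ((a : ℝ) ^ L * p.1) = 0 ∨ cell a r ((a : ℝ) ^ L * p.2) = 0) :=
        fun h' => hp ⟨h, h'⟩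
      push Not at h'
      simp [h, hg, h'.1, h'.2]
    · simp [h]

/-! ### Cutting a sequence of polynomials by a lower set of indices -/

/-- Rectangles and discs cut out lower sets of indices. If the spectra of the polynomials lie in
squares placed along the diagonal, then a lower set contains the squares up to some place and misses
the squares after that place, so it cuts at most one polynomial. -/
lemma exists_cut {a : ℕ} {D : Set (ℕ × ℕ)} (hD : IsLowerSet D) {A B : ℕ → ℕ}
    (hAB : ∀ i j, i < j → B i ≤ A j) (c : ℕ → ℕ × ℕ →₀ ℂ)
    (hc : ∀ j, ↑(c j).support ⊆ box (A j) (B j)) (J : ℕ) :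
    ∃ t ≤ J, (t < J → ¬ box (A t) (B t) ⊆ D) ∧ ∀ p,
      ∑ j ∈ Finset.range J, partialSum a D (c j) p
        = ∑ j ∈ Finset.range t, partialSum a Set.univ (c j) p
          + if t < J then partialSum a D (c t) p else 0 := by
  classical
  by_cases hall : ∀ j < J, box (A j) (B j) ⊆ D
  · refine ⟨J, le_rfl, fun h => absurd h (lt_irrefl _), fun p => ?_⟩
    simp only [lt_irrefl, if_false, add_zero]
    exact Finset.sum_congr rfl fun j hj =>
      partialSum_of_subset ((hc j).trans (hall j (Finset.mem_range.1 hj))) p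
  · push Not at hall
    set t := Nat.find hall with ht
    obtain ⟨htJ, hts⟩ := Nat.find_spec hall
    rw [← ht] at htJ hts
    have hlt : ∀ j < t, box (A j) (B j) ⊆ D := by
      intro j hj
      by_contra h
      exact Nat.find_min hall hj ⟨hj.trans htJ, h⟩
    have hgt : ∀ j, t < j → Disjoint (↑(c j).support : Set (ℕ × ℕ)) D := by
      intro j hj
      rw [Set.disjoint_left]
      intro n hn hnD
      apply hts
      rintro l ⟨hl1, hl2⟩
      have hn' := hc j hn
      have := hAB t j hj
      refine hD ?_ hnD
      exact ⟨hl1.2.le.trans (this.trans hn'.1.1), hl2.2.le.trans (this.trans hn'.2.1)⟩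
    refine ⟨t, htJ.le, fun _ => hts, fun p => ?_⟩
    rw [if_pos htJ, ← Finset.sum_range_add_sum_Ico _ (Nat.succ_le_of_lt htJ),
      Finset.sum_range_succ, Finset.sum_eq_zero (s := Finset.Ico t.succ J), add_zero]
    · congr 1
      exact Finset.sum_congr rfl fun j hj =>
        partialSum_of_subset ((hc j).trans (hlt j (Finset.mem_range.1 hj))) p
    · exact fun j hj => partialSum_of_disjoint
        (hgt j (Nat.lt_of_succ_le (Finset.mem_Ico.1 hj).1)) p

/-! ### Polynomials adapted to a step function -/

/-- The polynomial with coefficients `c` and spectrum in `[N₀, N₁)²` represents `F` off the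
exceptional set `B`, with small coefficients, and each of its truncations by a lower set is
controlled by `F` off `B`; all errors are at most `δ`. -/
structure IsBlock (a : ℕ) (F : ℝ × ℝ → ℂ) (δ : ℝ) (N₀ N₁ : ℕ) (c : ℕ × ℕ →₀ ℂ)
    (B : Set (ℝ × ℝ)) : Prop where
  lt : N₀ < N₁
  support_subset : ↑c.support ⊆ box N₀ N₁
  measurableSet : MeasurableSet B
  volume_le : volume (B ∩ unitSquare) ≤ ENNReal.ofReal δ
  norm_le_one : ∀ n, ‖c n‖ ≤ 1
  sum_rpow_le : ∑ n ∈ c.support, ‖c n‖ ^ (2 + δ) ≤ δ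
  eq_off : ∀ p ∉ B, partialSum a Set.univ c p = F p
  norm_le_off : ∀ D : Set (ℕ × ℕ), IsLowerSet D → ∃ h : ℝ × ℝ → ℂ, Measurable h ∧
    ∫⁻ p in unitSquare, ‖h p‖ₑ ≤ ENNReal.ofReal δ ∧
    ∀ p ∉ B, ‖partialSum a D c p‖ ≤ ‖F p‖ + ‖h p‖

/-- Coefficients bounded by `η` with bounded sum of squares have a small sum of powers with exponent
`2 + δ`. -/
lemma sum_rpow_le_of_sum_sq {ι : Type*} (s : Finset ι) (b : ι → ℂ) {δ η : ℝ} (hδ : 0 < δ)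
    (hη : 0 ≤ η) (h : ∑ n ∈ s, ‖b n‖ ^ 2 ≤ η ^ 2) :
    (∀ n ∈ s, ‖b n‖ ≤ η) ∧ ∑ n ∈ s, ‖b n‖ ^ (2 + δ) ≤ η ^ 2 * η ^ δ := by
  have h1 : ∀ n ∈ s, ‖b n‖ ≤ η := fun n hn =>
    le_of_sq_le_sq ((Finset.single_le_sum (f := fun n => ‖b n‖ ^ 2)
      (fun _ _ => by positivity) hn).trans h) hη
  refine ⟨h1, ?_⟩
  calc ∑ n ∈ s, ‖b n‖ ^ (2 + δ) ≤ ∑ n ∈ s, ‖b n‖ ^ 2 * η ^ δ := by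
        refine Finset.sum_le_sum fun n hn => ?_
        rw [Real.rpow_add' (norm_nonneg _) (by positivity)]
        have := Real.rpow_le_rpow (norm_nonneg _) (h1 n hn) hδ.le
        norm_cast
        gcongr
    _ = (∑ n ∈ s, ‖b n‖ ^ 2) * η ^ δ := by rw [Finset.sum_mul]
    _ ≤ η ^ 2 * η ^ δ := by gcongr

lemma exists_eq_of_sum_ne_zero {A B : ℕ → ℕ} (hAB : ∀ i j, i < j → B i ≤ A j)
    (c : ℕ → ℕ × ℕ →₀ ℂ) (hc : ∀ j, ↑(c j).support ⊆ box (A j) (B j)) (J : ℕ) {n : ℕ × ℕ}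
    (hn : (∑ j ∈ Finset.range J, c j) n ≠ 0) :
    ∃ j ∈ Finset.range J, (∑ j ∈ Finset.range J, c j) n = c j n ∧ c j n ≠ 0 := by
  rw [Finsupp.finsetSum_apply] at hn ⊢
  obtain ⟨j, hj, hjn⟩ := Finset.exists_ne_zero_of_sum_ne_zero hn
  refine ⟨j, hj, Finset.sum_eq_single_of_mem j hj fun i _ hij => ?_, hjn⟩
  by_contra hin
  have h1 := hc j (Finsupp.mem_support_iff.2 hjn)
  have h2 := hc i (Finsupp.mem_support_iff.2 hin)
  have h1a := h1.1.1
  have h1b := h1.1.2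
  have h2a := h2.1.1
  have h2b := h2.1.2
  rcases lt_or_gt_of_ne hij with h | h
  · have := hAB _ _ h; omega
  · have := hAB _ _ h; omega

lemma sum_support_le {A B : ℕ → ℕ} (hAB : ∀ i j, i < j → B i ≤ A j)
    (c : ℕ → ℕ × ℕ →₀ ℂ) (hc : ∀ j, ↑(c j).support ⊆ box (A j) (B j)) (J : ℕ)
    (φ : ℂ → ℝ) (hφ : ∀ z, 0 ≤ φ z) (hφ0 : φ 0 = 0) :
    ∑ n ∈ (∑ j ∈ Finset.range J, c j).support, φ ((∑ j ∈ Finset.range J, c j) n)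
      ≤ ∑ j ∈ Finset.range J, ∑ n ∈ (c j).support, φ (c j n) := by
  classical
  calc ∑ n ∈ (∑ j ∈ Finset.range J, c j).support, φ ((∑ j ∈ Finset.range J, c j) n)
      ≤ ∑ n ∈ (∑ j ∈ Finset.range J, c j).support, ∑ j ∈ Finset.range J, φ (c j n) := by
        refine Finset.sum_le_sum fun n hn => ?_
        obtain ⟨j, hj, h, -⟩ := exists_eq_of_sum_ne_zero hAB c hc J (Finsupp.mem_support_iff.1 hn)
        rw [h]
        exact Finset.single_le_sum (f := fun j => φ (c j n)) (fun _ _ => hφ _) hj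
    _ = ∑ j ∈ Finset.range J, ∑ n ∈ (∑ j ∈ Finset.range J, c j).support, φ (c j n) :=
        Finset.sum_comm
    _ ≤ ∑ j ∈ Finset.range J, ∑ n ∈ (c j).support, φ (c j n) := by
        refine Finset.sum_le_sum fun j _ => ?_
        rw [← Finset.sum_filter_add_sum_filter_not _ (fun n => n ∈ (c j).support),
          Finset.sum_eq_zero (s := Finset.filter (fun n => ¬ n ∈ (c j).support) _), add_zero]
        · refine Finset.sum_le_sum_of_subset_of_nonneg (fun n hn => (Finset.mem_filter.1 hn).2)
            fun _ _ _ => hφ _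
        · intro n hn
          rw [Finsupp.notMem_support_iff.1 (Finset.mem_filter.1 hn).2, hφ0]

/-- Every step function constant on the cells of some rank is represented by a block. The cells are
refined until every single piece is small in `L²`; since the pieces live on disjoint cells, the
complete pieces add up to at most the step function. -/
theorem exists_isBlock {a : ℕ} (ha : 2 ≤ a) (m₀ : ℕ) (γ : ℕ → ℕ → ℂ) {C : ℝ}
    (hC : ∀ i k, ‖γ i k‖ ≤ C) {δ : ℝ} (hδ : 0 < δ) (N₀ : ℕ) :
    ∃ N₁ c B, IsBlock a (fun p => γ (cell a m₀ p.1) (cell a m₀ p.2)) δ N₀ N₁ c B := by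
  classical
  have ha1 : (1 : ℝ) < a := by exact_mod_cast (by omega : 1 < a)
  have hC0 : 0 ≤ C := (norm_nonneg _).trans (hC 0 0)
  have hlim : Tendsto (fun m : ℕ => ((a : ℝ) ^ m)⁻¹) atTop (𝓝 0) :=
    tendsto_inv_atTop_zero.comp (tendsto_pow_atTop_atTop_of_one_lt ha1)
  -- `r` makes the exceptional set small
  obtain ⟨r, hr⟩ : ∃ r : ℕ, 2 * ((a : ℝ) ^ r)⁻¹ ≤ δ := by
    have h := hlim.const_mul 2
    rw [mul_zero] at h
    exact (h.eventually (ge_mem_nhds hδ)).exists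
  set K : ℝ := (C + 1) * (a : ℝ) ^ (2 * r) with hK
  have hK0 : 0 < K := by positivity
  have hη0 : Tendsto (fun m : ℕ => K * ((a : ℝ) ^ m)⁻¹) atTop (𝓝 0) := by
    simpa using hlim.const_mul K
  -- the rank `m` makes the `ℓ²` norm of each piece small
  obtain ⟨m, hm₀, hη1, hηδ, hηV⟩ : ∃ m, m₀ ≤ m ∧ K * ((a : ℝ) ^ m)⁻¹ ≤ 1 ∧
      K * ((a : ℝ) ^ m)⁻¹ ≤ δ ∧ K ^ 2 * (K * ((a : ℝ) ^ m)⁻¹) ^ δ ≤ δ := by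
    have h1 : Tendsto (fun m : ℕ => K ^ 2 * (K * ((a : ℝ) ^ m)⁻¹) ^ δ) atTop (𝓝 0) := by
      have := (hη0.rpow_const (p := δ) (Or.inr hδ.le)).const_mul (K ^ 2)
      rwa [Real.zero_rpow hδ.ne', mul_zero] at this
    exact ((eventually_ge_atTop m₀).and ((hη0.eventually (ge_mem_nhds one_pos)).and
      ((hη0.eventually (ge_mem_nhds hδ)).and (h1.eventually (ge_mem_nhds hδ))))).exists
  obtain ⟨l, rfl⟩ := Nat.exists_eq_add_of_le hm₀
  set m := m₀ + l with hm
  set η : ℝ := K * ((a : ℝ) ^ m)⁻¹ with hη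
  have hηpos : 0 < η := by positivity
  set n := a ^ m with hn
  have hn0 : 0 < n := by positivity
  set γ' : ℕ → ℂ := fun j => γ (j / n / a ^ l) (j % n / a ^ l) with hγ'
  set L₀ := max m N₀ with hL₀
  have hpiece : ∀ j : ℕ, ∃ (c : ℕ × ℕ →₀ ℂ) (B : Set (ℝ × ℝ)), j < n * n →
      ↑c.support ⊆ box (a ^ (L₀ + r * j)) (a ^ (L₀ + r * j + r)) ∧ MeasurableSet B ∧
      volume (B ∩ unitSquare)
        ≤ ENNReal.ofReal (2 * ((a : ℝ) ^ m)⁻¹ * ((a : ℝ) ^ m)⁻¹ * ((a : ℝ) ^ r)⁻¹) ∧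
      ∑ n ∈ c.support, ‖c n‖ ^ 2 ≤ (‖γ' j‖ * (a : ℝ) ^ (2 * r) * ((a : ℝ) ^ m)⁻¹) ^ 2 ∧
      ∀ p ∉ B, partialSum a Set.univ c p
        = if cell a m p.1 = j / n ∧ cell a m p.2 = j % n then γ' j else 0 := by
    intro j
    by_cases hj : j < n * n
    · obtain ⟨c, B, h⟩ := exists_polynomial_cell_prod ha
        (show m ≤ L₀ + r * j from (le_max_left _ _).trans (Nat.le_add_right _ _)) r
        (Nat.div_lt_of_lt_mul hj) (Nat.mod_lt j hn0) (γ' j)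
      exact ⟨c, B, fun _ => h⟩
    · exact ⟨0, ∅, fun h => absurd h hj⟩
  choose c₀ B₀ hcB using hpiece
  -- pieces with index at least `n * n` are replaced by zero
  set c : ℕ → ℕ × ℕ →₀ ℂ := fun j => if j < n * n then c₀ j else 0 with hc
  have hcj : ∀ j < n * n, c j = c₀ j := fun j hj => if_pos hj
  have hsupp : ∀ j, ↑(c j).support ⊆ box (a ^ (L₀ + r * j)) (a ^ (L₀ + r * j + r)) := by
    intro j
    by_cases hj : j < n * n
    · rw [hcj j hj]; exact (hcB j hj).1
    · simp [hc, hj]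
  have hAB : ∀ i j, i < j → a ^ (L₀ + r * i + r) ≤ a ^ (L₀ + r * j) := by
    intro i j hij
    refine Nat.pow_le_pow_right (by omega) ?_
    have := Nat.mul_le_mul_left r (Nat.succ_le_of_lt hij)
    rw [Nat.mul_succ] at this
    omega
  have hl2 : ∀ j, ∑ n ∈ (c j).support, ‖c j n‖ ^ 2 ≤ η ^ 2 := by
    intro j
    by_cases hj : j < n * n
    · rw [hcj j hj]
      refine (hcB j hj).2.2.2.1.trans ?_
      have : ‖γ' j‖ ≤ C + 1 := (hC _ _).trans (by linarith)
      rw [hη, hK]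
      gcongr
    · simp only [hc, hj, if_false]
      simpa using by positivity
  set B := ⋃ j ∈ Finset.range (n * n), B₀ j with hB
  have hoff : ∀ p ∉ B, ∀ j < n * n, partialSum a Set.univ (c j) p
      = if j = cell a m p.1 * n + cell a m p.2 then γ (cell a m₀ p.1) (cell a m₀ p.2) else 0 := by
    intro p hp j hj
    have hpj : p ∉ B₀ j := fun h =>
      hp (Set.mem_biUnion (Finset.mem_coe.2 (Finset.mem_range.2 hj)) h)
    have hlt := cell_lt ha m p.2
    rw [hcj j hj, (hcB j hj).2.2.2.2 p hpj]
    have hiff : (cell a m p.1 = j / n ∧ cell a m p.2 = j % n) ↔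
        j = cell a m p.1 * n + cell a m p.2 := by
      constructor
      · rintro ⟨h1, h2⟩
        rw [h1, h2, Nat.div_add_mod']
      · rintro rfl
        rw [Nat.add_comm, Nat.add_mul_div_right _ _ hn0, Nat.add_mul_mod_self_right,
          Nat.div_eq_of_lt hlt, Nat.mod_eq_of_lt hlt]
        simp
    rw [if_congr hiff rfl rfl]
    by_cases h : j = cell a m p.1 * n + cell a m p.2
    · rw [if_pos h, if_pos h]
      obtain ⟨h1, h2⟩ := hiff.2 h
      simp only [hγ']
      rw [← h1, ← h2, ← cell_eq_cell_add_div ha, ← cell_eq_cell_add_div ha]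
    · rw [if_neg h, if_neg h]
  have hidx : ∀ p : ℝ × ℝ, cell a m p.1 * n + cell a m p.2 < n * n := by
    intro p
    have h1 := cell_lt ha m p.1
    have h2 := cell_lt ha m p.2
    nlinarith
  have hcoef : ∀ ν, ‖(∑ j ∈ Finset.range (n * n), c j) ν‖ ≤ 1 := by
    intro ν
    by_cases hν : (∑ j ∈ Finset.range (n * n), c j) ν = 0
    · rw [hν]; simp
    · obtain ⟨j, -, h1, h2⟩ := exists_eq_of_sum_ne_zero hAB c hsupp _ hν
      rw [h1]
      exact ((sum_rpow_le_of_sum_sq _ _ hδ hηpos.le (hl2 j)).1 ν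
        (Finsupp.mem_support_iff.2 h2)).trans hη1
  have hrpow : ∑ ν ∈ (∑ j ∈ Finset.range (n * n), c j).support,
      ‖(∑ j ∈ Finset.range (n * n), c j) ν‖ ^ (2 + δ) ≤ δ := by
    refine (sum_support_le hAB c hsupp _ (fun z => ‖z‖ ^ (2 + δ)) (fun z => by positivity)
      (by rw [norm_zero, Real.zero_rpow (by positivity)])).trans ?_
    refine (Finset.sum_le_sum fun j _ =>
      (sum_rpow_le_of_sum_sq _ _ hδ hηpos.le (hl2 j)).2).trans ?_
    rw [Finset.sum_const, Finset.card_range, nsmul_eq_mul]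
    refine le_trans (le_of_eq ?_) hηV
    rw [hη, hn]
    push_cast
    have : (a : ℝ) ^ m ≠ 0 := by positivity
    field_simp
  refine ⟨a ^ (L₀ + r * (n * n)), ∑ j ∈ Finset.range (n * n), c j, B, ⟨?_, ?_, ?_, ?_, hcoef, hrpow,
    ?_, ?_⟩⟩
  · calc N₀ ≤ L₀ + r * (n * n) := (le_max_right _ _).trans (Nat.le_add_right _ _)
      _ < a ^ (L₀ + r * (n * n)) := Nat.lt_pow_self (by omega)
  · intro ν hν
    obtain ⟨j, hj, -, h2⟩ := exists_eq_of_sum_ne_zero hAB c hsupp _ (Finsupp.mem_support_iff.1 hν)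
    have h3 := hsupp j (Finsupp.mem_support_iff.2 h2)
    have h4 : N₀ ≤ a ^ (L₀ + r * j) :=
      ((le_max_right _ _).trans (Nat.le_add_right _ _)).trans (Nat.lt_pow_self (by omega)).le
    have h5 : a ^ (L₀ + r * j + r) ≤ a ^ (L₀ + r * (n * n)) := hAB j _ (Finset.mem_range.1 hj)
    exact ⟨⟨h4.trans h3.1.1, h3.1.2.trans_le h5⟩, ⟨h4.trans h3.2.1, h3.2.2.trans_le h5⟩⟩
  · exact Finset.measurableSet_biUnion _ fun j hj => (hcB j (Finset.mem_range.1 hj)).2.1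
  · rw [hB, Set.iUnion₂_inter]
    refine (measure_biUnion_finset_le _ _).trans ((Finset.sum_le_sum fun j hj =>
      (hcB j (Finset.mem_range.1 hj)).2.2.1).trans ?_)
    rw [Finset.sum_const, Finset.card_range, nsmul_eq_mul, ← ENNReal.ofReal_natCast,
      ← ENNReal.ofReal_mul (by positivity)]
    refine ENNReal.ofReal_le_ofReal (le_trans (le_of_eq ?_) hr)
    rw [hn]
    push_cast
    have : (a : ℝ) ^ m ≠ 0 := by positivity
    field_simp
  · intro p hp
    rw [partialSum_finset_sum, Finset.sum_congr rfl fun j hj => hoff p hp j (Finset.mem_range.1 hj),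
      Finset.sum_ite_eq' , if_pos (Finset.mem_range.2 (hidx p))]
  · intro D hD
    obtain ⟨t, htJ, -, ht⟩ := exists_cut (a := a) hD hAB c hsupp (n * n)
    refine ⟨fun p => if t < n * n then partialSum a D (c t) p else 0, ?_, ?_, fun p hp => ?_⟩
    · by_cases h : t < n * n
      · simpa only [h, if_true] using measurable_partialSum a D (c t)
      · simpa only [h, if_false] using measurable_const
    · refine le_trans ?_ ((lintegral_partialSum_le ha D (c t) hηpos (hl2 t)).trans
        (ENNReal.ofReal_le_ofReal hηδ))
      refine lintegral_mono fun p => ?_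
      split_ifs <;> simp
    · rw [partialSum_finset_sum, ht p]
      refine (norm_add_le _ _).trans (add_le_add_left ?_ _)
      rw [Finset.sum_congr rfl fun j hj =>
        hoff p hp j ((Finset.mem_range.1 hj).trans_le htJ), Finset.sum_ite_eq']
      split_ifs <;> simp

/-! ### Dense sequences of step functions -/

lemma exists_denseRange_ne_zero : ∃ d : ℕ → ℂ, DenseRange d ∧ ∀ n, d n ≠ 0 := by
  obtain ⟨t, ht, htc, htd⟩ := (dense_compl_singleton (0 : ℂ)).exists_countable_dense_subset
  obtain ⟨d, rfl⟩ := htc.exists_eq_range htd.nonempty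
  exact ⟨d, htd, fun n => ht ⟨n, rfl⟩⟩

/-- Arrays of nonzero numbers `γ s` together with ranks `rk s` such that every finite array is
approximated by `γ s` for arbitrarily large `s`. -/
lemma exists_dense_arrays (a : ℕ) :
    ∃ (rk : ℕ → ℕ) (γ : ℕ → ℕ → ℕ → ℂ), (∀ s, ∃ C, ∀ i k, ‖γ s i k‖ ≤ C) ∧
      (∀ s i k, γ s i k ≠ 0) ∧
      ∀ (m : ℕ) (θ : ℕ → ℕ → ℂ) (η : ℝ), 0 < η → ∀ b, ∃ s ≥ b, rk s = m ∧
        ∀ i < a ^ m, ∀ k < a ^ m, ‖θ i k - γ s i k‖ < η := by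
  classical
  obtain ⟨d, hd, hd0⟩ := exists_denseRange_ne_zero
  obtain ⟨e, he⟩ := exists_surjective_nat (ℕ × (ℕ × ℕ →₀ ℕ))
  refine ⟨fun s => (e s.unpair.1).1, fun s i k => d ((e s.unpair.1).2 (i, k)), ?_,
    fun s i k => hd0 _, ?_⟩
  · intro s
    have hfin : (Set.range fun n => ‖d ((e s.unpair.1).2 n)‖).Finite := by
      have h1 : (Set.range (e s.unpair.1).2).Finite := by
        refine (((e s.unpair.1).2.support.image (e s.unpair.1).2).finite_toSet.union
          (Set.finite_singleton 0)).subset ?_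
        rintro _ ⟨n, rfl⟩
        by_cases h : (e s.unpair.1).2 n = 0
        · exact Or.inr h
        · exact Or.inl (Finset.mem_coe.2 (Finset.mem_image_of_mem _ (Finsupp.mem_support_iff.2 h)))
      refine (h1.image fun n => ‖d n‖).subset ?_
      rintro _ ⟨n, rfl⟩
      exact ⟨_, ⟨n, rfl⟩, rfl⟩
    obtain ⟨C, hC⟩ := hfin.bddAbove
    exact ⟨C, fun i k => hC ⟨(i, k), rfl⟩⟩
  · intro m θ η hη b
    have h1 : ∀ i k, ∃ j, ‖θ i k - d j‖ < η := fun i k => by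
      obtain ⟨j, hj⟩ := hd.exists_dist_lt (θ i k) hη
      exact ⟨j, by rwa [← dist_eq_norm]⟩
    choose J hJ using h1
    obtain ⟨u, hu⟩ := he (m, Finsupp.indicator (Finset.range (a ^ m) ×ˢ Finset.range (a ^ m))
      fun n _ => J n.1 n.2)
    refine ⟨Nat.pair u b, Nat.right_le_pair u b, by simp [hu], fun i hi k hk => ?_⟩
    simp only [Nat.unpair_pair, hu]
    rw [Finsupp.indicator_of_mem (by simp [hi, hk])]
    exact hJ i k

lemma restrict_unitSquare_eq_Ico : (volume : Measure (ℝ × ℝ)).restrict unitSquare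
    = volume.restrict (Set.Ico (0 : ℝ) 1 ×ˢ Set.Ico (0 : ℝ) 1) := by
  rw [restrict_unitSquare, Measure.volume_eq_prod, ← Measure.prod_restrict,
    Measure.restrict_congr_set Ico_ae_eq_Icc]

lemma abs_sub_cell_div_le {a : ℕ} (ha : 2 ≤ a) (m : ℕ) {x : ℝ} (hx : x ∈ Set.Ico (0 : ℝ) 1) :
    |x - cell a m x / (a : ℝ) ^ m| ≤ ((a : ℝ) ^ m)⁻¹ := by
  have hp : (0 : ℝ) < (a : ℝ) ^ m := by positivity
  have hc : cell a m x = ⌊(a : ℝ) ^ m * x⌋₊ := by rw [cell, Int.fract_eq_self.2 ⟨hx.1, hx.2⟩]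
  have h1 : (cell a m x : ℝ) ≤ (a : ℝ) ^ m * x := by
    rw [hc]; exact Nat.floor_le (mul_nonneg hp.le hx.1)
  have h2 : (a : ℝ) ^ m * x < cell a m x + 1 := by rw [hc]; exact Nat.lt_floor_add_one _
  have h3 : x - cell a m x / (a : ℝ) ^ m = ((a : ℝ) ^ m * x - cell a m x) * ((a : ℝ) ^ m)⁻¹ := by
    field_simp
  rw [h3, abs_mul, abs_of_pos (inv_pos.2 hp), abs_of_nonneg (by linarith)]
  exact mul_le_of_le_one_left (inv_pos.2 hp).le (by linarith)

/-- Step functions approximate integrable functions, for every measure dominated by Lebesgue measure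
on the square. -/
lemma exists_step_lintegral_sub_le {a : ℕ} (ha : 2 ≤ a) {ν : Measure (ℝ × ℝ)}
    (hν : ν ≤ volume.restrict unitSquare) {f : ℝ × ℝ → ℂ} (hf : Integrable f ν) {η : ℝ}
    (hη : 0 < η) :
    ∃ (m : ℕ) (θ : ℕ → ℕ → ℂ), ∀ γ : ℕ → ℕ → ℂ,
      (∀ i < a ^ m, ∀ k < a ^ m, ‖θ i k - γ i k‖ < η / 4) →
      ∫⁻ p, ‖f p - γ (cell a m p.1) (cell a m p.2)‖ₑ ∂ν ≤ ENNReal.ofReal η := by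
  have hfin : IsFiniteMeasure ν := isFiniteMeasure_of_le _ hν
  obtain ⟨g, hgc, hfg, hg, hgi⟩ := hf.exists_hasCompactSupport_lintegral_sub_le
    (ε := ENNReal.ofReal (η / 2)) (by simpa using hη)
  have hu := hgc.uniformContinuous_of_continuous hg
  obtain ⟨δ, hδ, hgδ⟩ := Metric.uniformContinuous_iff.1 hu (η / 4) (by positivity)
  obtain ⟨m, hm⟩ : ∃ m : ℕ, ((a : ℝ) ^ m)⁻¹ < δ := by
    have h := tendsto_inv_atTop_zero.comp (tendsto_pow_atTop_atTop_of_one_lt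
      (show (1 : ℝ) < a by exact_mod_cast (by omega : 1 < a)))
    exact (h.eventually (gt_mem_nhds hδ)).exists
  refine ⟨m, fun i k => g (i / (a : ℝ) ^ m, k / (a : ℝ) ^ m), fun γ hγ => ?_⟩
  have hpt : ∀ p ∈ Set.Ico (0 : ℝ) 1 ×ˢ Set.Ico (0 : ℝ) 1,
      ‖g p - γ (cell a m p.1) (cell a m p.2)‖ₑ ≤ ENNReal.ofReal (η / 2) := by
    intro p hp
    rw [← ofReal_norm]
    apply ENNReal.ofReal_le_ofReal
    have h1 := hγ _ (cell_lt ha m p.1) _ (cell_lt ha m p.2)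
    have h2 : dist p (cell a m p.1 / (a : ℝ) ^ m, cell a m p.2 / (a : ℝ) ^ m) < δ := by
      rw [Prod.dist_eq, max_lt_iff, Real.dist_eq, Real.dist_eq]
      exact ⟨(abs_sub_cell_div_le ha m hp.1).trans_lt hm,
        (abs_sub_cell_div_le ha m hp.2).trans_lt hm⟩
    have h3 := hgδ h2
    rw [dist_eq_norm] at h3
    have h4 := norm_add_le
      (g p - g (cell a m p.1 / (a : ℝ) ^ m, cell a m p.2 / (a : ℝ) ^ m))
      (g (cell a m p.1 / (a : ℝ) ^ m, cell a m p.2 / (a : ℝ) ^ m) - γ (cell a m p.1) (cell a m p.2))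
    rw [sub_add_sub_cancel] at h4
    linarith
  have hgF : ∫⁻ p, ‖g p - γ (cell a m p.1) (cell a m p.2)‖ₑ ∂ν ≤ ENNReal.ofReal (η / 2) := by
    calc ∫⁻ p, ‖g p - γ (cell a m p.1) (cell a m p.2)‖ₑ ∂ν
        ≤ ∫⁻ p in unitSquare, ‖g p - γ (cell a m p.1) (cell a m p.2)‖ₑ := lintegral_mono' hν le_rfl
      _ ≤ ∫⁻ _ in unitSquare, ENNReal.ofReal (η / 2) := by
          refine lintegral_mono_ae ?_
          rw [restrict_unitSquare_eq_Ico]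
          exact (ae_restrict_iff' (measurableSet_Ico.prod measurableSet_Ico)).2
            (Eventually.of_forall hpt)
      _ = ENNReal.ofReal (η / 2) := by rw [lintegral_const, measure_univ, mul_one]
  calc ∫⁻ p, ‖f p - γ (cell a m p.1) (cell a m p.2)‖ₑ ∂ν
      ≤ ∫⁻ p, (‖f p - g p‖ₑ + ‖g p - γ (cell a m p.1) (cell a m p.2)‖ₑ) ∂ν := by
        refine lintegral_mono fun p => ?_
        rw [← sub_add_sub_cancel (f p) (g p)]
        exact enorm_add_le _ _
    _ = ∫⁻ p, ‖f p - g p‖ₑ ∂ν + ∫⁻ p, ‖g p - γ (cell a m p.1) (cell a m p.2)‖ₑ ∂ν :=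
        lintegral_add_left' (hf.sub hgi).aestronglyMeasurable.enorm _
    _ ≤ ENNReal.ofReal (η / 2) + ENNReal.ofReal (η / 2) := add_le_add hfg hgF
    _ = ENNReal.ofReal η := by
        rw [← ENNReal.ofReal_add (by positivity) (by positivity), add_halves]

/-! ### The series of blocks -/

/-- Blocks with consecutive spectra which represent step functions that are dense in every weighted
space, each of them arbitrarily late. The step functions vanish nowhere, so that no block is
zero. -/
theorem exists_blocks {a : ℕ} (ha : 2 ≤ a) :
    ∃ (F : ℕ → ℝ × ℝ → ℂ) (M : ℕ → ℝ) (N : ℕ → ℕ) (c : ℕ → ℕ × ℕ →₀ ℂ) (B : ℕ → Set (ℝ × ℝ)),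
      N 0 = 1 ∧ (∀ s, IsBlock a (F s) ((1 / 2) ^ (s + 1)) (N s) (N (s + 1)) (c s) (B s)) ∧
      (∀ s, Measurable (F s)) ∧ (∀ s p, ‖F s p‖ ≤ M s) ∧ (∀ s p, F s p ≠ 0) ∧
      ∀ ν : Measure (ℝ × ℝ), ν ≤ volume.restrict unitSquare → ∀ f : ℝ × ℝ → ℂ, Integrable f ν →
        ∀ η : ℝ, 0 < η → ∀ b, ∃ s ≥ b, ∫⁻ p, ‖f p - F s p‖ₑ ∂ν ≤ ENNReal.ofReal η := by
  obtain ⟨rk, γ, hγC, hγ0, hγd⟩ := exists_dense_arrays a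
  choose M hM using hγC
  have hb : ∀ s N₀, ∃ N₁ c B, IsBlock a (fun p => γ s (cell a (rk s) p.1) (cell a (rk s) p.2))
      ((1 / 2) ^ (s + 1)) N₀ N₁ c B := fun s N₀ =>
    exists_isBlock ha (rk s) (γ s) (hM s) (by positivity) N₀
  choose nxt c B hblock using hb
  set N : ℕ → ℕ := fun s => Nat.rec 1 nxt s with hN
  refine ⟨fun s p => γ s (cell a (rk s) p.1) (cell a (rk s) p.2), M, N, fun s => c s (N s),
    fun s => B s (N s), rfl, fun s => hblock s (N s), fun s => ?_, fun s p => hM s _ _,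
    fun s p => hγ0 s _ _, ?_⟩
  · exact (measurable_of_countable fun n : ℕ × ℕ => γ s n.1 n.2).comp
      (((measurable_cell a _).comp measurable_fst).prodMk
        ((measurable_cell a _).comp measurable_snd))
  · intro ν hν f hf η hη b
    obtain ⟨m, θ, h⟩ := exists_step_lintegral_sub_le ha hν hf hη
    obtain ⟨s, hs, rfl, hθ⟩ := hγd m θ (η / 4) (by positivity) b
    exact ⟨s, hs, h _ hθ⟩

/-! ### The weight -/

lemma tsum_ofReal_half_pow (s₀ : ℕ) :
    ∑' s, ENNReal.ofReal ((1 / 2) ^ (s + s₀ + 1)) = ENNReal.ofReal ((1 / 2) ^ s₀) := by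
  have h := hasSum_geometric_two' ((1 / 2 : ℝ) ^ s₀)
  have h1 : (fun n : ℕ => (1 / 2 : ℝ) ^ s₀ / 2 / 2 ^ n) = fun s => (1 / 2) ^ (s + s₀ + 1) := by
    funext s
    rw [pow_succ, pow_add, one_div_pow 2 s]
    ring
  rw [h1] at h
  rw [← ENNReal.ofReal_tsum_of_nonneg (fun s => by positivity) h.summable, h.tsum_eq]

/-- If the sets `B s` have summable measures, there is a weight which is `1` off a set of small
measure and which makes all late sets `B s` as small as prescribed. It is the infimum of the
numbers `w s` over the late `s` with `p ∈ B s`; this is positive unless `p` lies in infinitely many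
of the sets, which happens on a null set only. -/
theorem exists_weight {B : ℕ → Set (ℝ × ℝ)} (hBm : ∀ s, MeasurableSet (B s))
    (hB : ∀ s, volume (B s ∩ unitSquare) ≤ ENNReal.ofReal ((1 / 2) ^ (s + 1))) {w : ℕ → ℝ}
    (hw0 : ∀ s, 0 < w s) (hw1 : ∀ s, w s ≤ 1) {ε : ℝ} (hε : 0 < ε) :
    ∃ μ : ℝ × ℝ → ℝ, Measurable μ ∧ (∀ p, 0 < μ p ∧ μ p ≤ 1) ∧
      volume {p ∈ unitSquare | μ p ≠ 1} < ENNReal.ofReal ε ∧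
      ∃ s₀, ∀ s ≥ s₀, weightedMeasure μ (B s) ≤ ENNReal.ofReal (w s) := by
  classical
  obtain ⟨s₀, hs₀⟩ := exists_pow_lt_of_lt_one hε (show (1 / 2 : ℝ) < 1 by norm_num)
  set f : ℕ → ℝ × ℝ → ℝ := fun s p => if p ∈ B (s + s₀) then w (s + s₀) else 1 with hf
  set Z : Set (ℝ × ℝ) := limsup B atTop with hZ
  have hZm : MeasurableSet Z := MeasurableSet.measurableSet_limsup hBm
  have hZ0 : volume.restrict unitSquare Z = 0 := by
    apply measure_limsup_atTop_eq_zero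
    refine ne_top_of_le_ne_top ?_ (ENNReal.tsum_le_tsum fun s =>
      (Measure.restrict_apply (hBm s)).trans_le (hB s))
    have := tsum_ofReal_half_pow 0
    simp only [add_zero] at this
    rw [this]
    exact ENNReal.ofReal_ne_top
  have hf0 : ∀ s p, 0 < f s p := fun s p => by
    simp only [hf]; split_ifs; exacts [hw0 _, one_pos]
  have hf1 : ∀ s p, f s p ≤ 1 := fun s p => by
    simp only [hf]; split_ifs; exacts [hw1 _, le_rfl]
  have hbdd : ∀ p, BddBelow (Set.range fun s => f s p) := fun p =>
    ⟨0, by rintro _ ⟨s, rfl⟩; exact (hf0 s p).le⟩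
  have hfm : ∀ s, Measurable (f s) := fun s =>
    Measurable.ite (hBm _) measurable_const measurable_const
  have hmin : ∀ p ∉ Z, ∃ s, ⨅ s, f s p = f s p := by
    intro p hp
    rw [hZ, mem_limsup_iff_frequently_mem, not_frequently, eventually_atTop] at hp
    obtain ⟨b, hb⟩ := hp
    have hfin : (Set.range fun s => f s p).Finite := by
      refine (((Finset.range b).image fun s => f s p).finite_toSet.union
        (Set.finite_singleton 1)).subset ?_
      rintro _ ⟨s, rfl⟩
      by_cases hs : s < b
      · exact Or.inl (Finset.mem_coe.2
          (Finset.mem_image_of_mem (fun s => f s p) (Finset.mem_range.2 hs)))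
      · exact Or.inr (if_neg (hb (s + s₀) (by omega)))
    obtain ⟨s, hs⟩ := (Set.range_nonempty fun s => f s p).csInf_mem hfin
    exact ⟨s, hs.symm⟩
  set μ : ℝ × ℝ → ℝ := fun p => if p ∈ Z then 1 else ⨅ s, f s p with hμ
  have hμm : Measurable μ := Measurable.ite hZm measurable_const (Measurable.iInf hfm)
  refine ⟨μ, hμm, fun p => ?_, ?_, s₀, fun s hs => ?_⟩
  · by_cases hp : p ∈ Z
    · simp [hμ, hp]
    · obtain ⟨s, hs⟩ := hmin p hp
      simp only [hμ, hp, if_false, hs]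
      exact ⟨hf0 s p, hf1 s p⟩
  · have hsub : {p ∈ unitSquare | μ p ≠ 1} ⊆ ⋃ s, (B (s + s₀) ∩ unitSquare) := by
      rintro p ⟨hpT, hp1⟩
      have hpZ : p ∉ Z := fun h => hp1 (if_pos h)
      obtain ⟨s, hs⟩ := hmin p hpZ
      refine Set.mem_iUnion.2 ⟨s, ?_, hpT⟩
      by_contra h
      apply hp1
      simp only [hμ, hpZ, if_false, hs]
      exact if_neg h
    calc volume {p ∈ unitSquare | μ p ≠ 1}
        ≤ ∑' s, volume (B (s + s₀) ∩ unitSquare) :=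
          (measure_mono hsub).trans (measure_iUnion_le _)
      _ ≤ ∑' s, ENNReal.ofReal ((1 / 2) ^ (s + s₀ + 1)) := ENNReal.tsum_le_tsum fun s => hB _
      _ = ENNReal.ofReal ((1 / 2) ^ s₀) := tsum_ofReal_half_pow s₀
      _ < ENNReal.ofReal ε := (ENNReal.ofReal_lt_ofReal_iff hε).2 hs₀
  · rw [weightedMeasure, withDensity_apply _ (hBm s)]
    have hae : ∀ᵐ p ∂(volume.restrict unitSquare), p ∉ Z := measure_eq_zero_iff_ae_notMem.1 hZ0
    calc ∫⁻ p in B s, ENNReal.ofReal (μ p) ∂(volume.restrict unitSquare)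
        ≤ ∫⁻ _ in B s, ENNReal.ofReal (w s) ∂(volume.restrict unitSquare) := by
          refine lintegral_mono_ae ?_
          filter_upwards [ae_restrict_of_ae hae, ae_restrict_mem (hBm s)] with p hpZ hpB
          apply ENNReal.ofReal_le_ofReal
          obtain ⟨l, rfl⟩ := Nat.exists_eq_add_of_le' hs
          simp only [hμ, hpZ, if_false]
          refine (ciInf_le (hbdd p) l).trans (le_of_eq ?_)
          exact if_pos hpB
      _ ≤ ENNReal.ofReal (w s) * 1 := by
          rw [lintegral_const]
          gcongr
          rw [Measure.restrict_apply_univ]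
          exact prob_le_one
      _ = ENNReal.ofReal (w s) := mul_one _

lemma weightedMeasure_le {μ : ℝ × ℝ → ℝ} (hμ : ∀ p, μ p ≤ 1) :
    weightedMeasure μ ≤ volume.restrict unitSquare := by
  calc weightedMeasure μ ≤ (volume.restrict unitSquare).withDensity 1 := by
        refine withDensity_mono (Eventually.of_forall fun p => ?_)
        simpa using ENNReal.ofReal_le_ofReal (hμ p)
    _ = volume.restrict unitSquare := withDensity_one

/-! ### Coefficients of the whole series -/

lemma eq_of_mem_support {N : ℕ → ℕ} (hN : StrictMono N) {c : ℕ → ℕ × ℕ →₀ ℂ}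
    (hc : ∀ s, ↑(c s).support ⊆ box (N s) (N (s + 1))) {s t : ℕ} {n : ℕ × ℕ} (hs : c s n ≠ 0)
    (ht : c t n ≠ 0) : s = t := by
  have h1 := hc s (Finsupp.mem_support_iff.2 hs)
  have h2 := hc t (Finsupp.mem_support_iff.2 ht)
  have h3 := hN.lt_iff_lt.1 (h1.1.1.trans_lt h2.1.2)
  have h4 := hN.lt_iff_lt.1 (h2.1.1.trans_lt h1.1.2)
  omega

lemma exists_coeff {N : ℕ → ℕ} (hN : StrictMono N) {c : ℕ → ℕ × ℕ →₀ ℂ}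
    (hc : ∀ s, ↑(c s).support ⊆ box (N s) (N (s + 1))) :
    ∃ C : ℕ × ℕ → ℂ, (∀ s n, c s n ≠ 0 → C n = c s n) ∧ ∀ n, C n ≠ 0 → ∃ s, c s n ≠ 0 := by
  classical
  refine ⟨fun n => if h : ∃ s, c s n ≠ 0 then c h.choose n else 0, fun s n hs => ?_, fun n hn => ?_⟩
  · have h : ∃ s, c s n ≠ 0 := ⟨s, hs⟩
    simp only [dif_pos h]
    rw [eq_of_mem_support hN hc h.choose_spec hs]
  · by_contra h
    exact hn (dif_neg h)

lemma summable_coeff {C : ℕ × ℕ → ℂ} {c : ℕ → ℕ × ℕ →₀ ℂ}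
    (hcC : ∀ s n, c s n ≠ 0 → C n = c s n) (hCc : ∀ n, C n ≠ 0 → ∃ s, c s n ≠ 0)
    (h1 : ∀ s n, ‖c s n‖ ≤ 1)
    (h2 : ∀ s, ∑ n ∈ (c s).support, ‖c s n‖ ^ (2 + (1 / 2 : ℝ) ^ (s + 1)) ≤ (1 / 2) ^ (s + 1))
    {q : ℝ} (hq : 2 < q) : Summable fun n => ‖C n‖ ^ q := by
  have hq0 : q ≠ 0 := by linarith
  have hinner : ∀ s, HasSum (fun n => ‖c s n‖ ^ q) (∑ n ∈ (c s).support, ‖c s n‖ ^ q) := by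
    refine fun s => hasSum_sum_of_ne_finset_zero fun n hn => ?_
    rw [Finsupp.notMem_support_iff.1 hn, norm_zero, Real.zero_rpow hq0]
  have hsum : Summable fun x : ℕ × (ℕ × ℕ) => ‖c x.1 x.2‖ ^ q := by
    rw [summable_prod_of_nonneg fun x => by positivity]
    refine ⟨fun s => (hinner s).summable, ?_⟩
    rw [show (fun s => ∑' n, ‖c s n‖ ^ q) = fun s => ∑ n ∈ (c s).support, ‖c s n‖ ^ q from
      funext fun s => (hinner s).tsum_eq]
    have hgeom : Summable fun s : ℕ => (1 / 2 : ℝ) ^ (s + 1) :=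
      (summable_nat_add_iff 1).2 (summable_geometric_of_lt_one (by norm_num) (by norm_num))
    have hev : ∀ᶠ s : ℕ in atTop, (1 / 2 : ℝ) ^ (s + 1) < q - 2 :=
      (hgeom.tendsto_atTop_zero).eventually (gt_mem_nhds (by linarith))
    refine Summable.of_norm_bounded_eventually_nat hgeom ?_
    filter_upwards [hev] with s hs
    rw [Real.norm_of_nonneg (Finset.sum_nonneg fun _ _ => by positivity)]
    refine le_trans (Finset.sum_le_sum fun n hn => ?_) (h2 s)
    exact Real.rpow_le_rpow_of_exponent_ge
      (norm_pos_iff.2 (Finsupp.mem_support_iff.1 hn)) (h1 s n) (by linarith)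
  have hidx : ∀ n, ∃ s, ‖C n‖ ^ q ≤ ‖c s n‖ ^ q := by
    intro n
    by_cases hn : C n = 0
    · exact ⟨0, by rw [hn, norm_zero, Real.zero_rpow hq0]; positivity⟩
    · obtain ⟨s, hs⟩ := hCc n hn
      exact ⟨s, by rw [hcC s n hs]⟩
  choose idx hidx using hidx
  have hinj : Function.Injective fun n : ℕ × ℕ => (idx n, n) := fun _ _ h => (Prod.ext_iff.1 h).2
  have hcomp : Summable fun n => ‖c (idx n) n‖ ^ q := by
    have h := hsum.comp_injective hinj
    simp only [Function.comp_def] at h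
    exact h
  exact Summable.of_nonneg_of_le (fun n => Real.rpow_nonneg (norm_nonneg _) q) hidx hcomp

/-! ### Weighted norms of the blocks -/

lemma IsBlock.lintegral_le {a : ℕ} (ha : 2 ≤ a) {F : ℝ × ℝ → ℂ} {δ : ℝ} {N₀ N₁ : ℕ}
    {c : ℕ × ℕ →₀ ℂ} {B : Set (ℝ × ℝ)} (h : IsBlock a F δ N₀ N₁ c B) (hF : Measurable F) {M w : ℝ}
    (hM : ∀ p, ‖F p‖ ≤ M) (hw : w * (M + ∑ n ∈ c.support, ‖c n‖) ≤ δ)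
    {ν : Measure (ℝ × ℝ)} (hν : ν ≤ volume.restrict unitSquare) (hνB : ν B ≤ ENNReal.ofReal w) :
    ∫⁻ p, ‖F p - partialSum a Set.univ c p‖ₑ ∂ν ≤ ENNReal.ofReal δ ∧
    ∀ D : Set (ℕ × ℕ), IsLowerSet D → ∫⁻ p, ‖partialSum a D c p‖ₑ ∂ν
      ≤ ∫⁻ p, ‖F p‖ₑ ∂ν + ENNReal.ofReal δ + ENNReal.ofReal δ := by
  classical
  set G : ℝ := M + ∑ n ∈ c.support, ‖c n‖ with hG
  have hM0 : 0 ≤ M := (norm_nonneg _).trans (hM 0)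
  have hG0 : 0 ≤ G := add_nonneg hM0 (Finset.sum_nonneg fun _ _ => norm_nonneg _)
  have hB : ∫⁻ p, B.indicator (fun _ => ENNReal.ofReal G) p ∂ν ≤ ENNReal.ofReal δ := by
    rw [lintegral_indicator_const h.measurableSet, mul_comm]
    calc ν B * ENNReal.ofReal G ≤ ENNReal.ofReal w * ENNReal.ofReal G := by gcongr
      _ = ENNReal.ofReal (w * G) := (ENNReal.ofReal_mul' hG0).symm
      _ ≤ ENNReal.ofReal δ := ENNReal.ofReal_le_ofReal hw
  constructor
  · refine le_trans (lintegral_mono fun p => ?_) hB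
    by_cases hp : p ∈ B
    · rw [Set.indicator_of_mem hp, ← ofReal_norm]
      apply ENNReal.ofReal_le_ofReal
      exact (norm_sub_le _ _).trans (add_le_add (hM p) (norm_partialSum_le ha _ c p))
    · rw [h.eq_off p hp, sub_self, enorm_zero]
      exact zero_le
  · intro D hD
    obtain ⟨g, hg, hgδ, hgle⟩ := h.norm_le_off D hD
    calc ∫⁻ p, ‖partialSum a D c p‖ₑ ∂ν
        ≤ ∫⁻ p, (‖F p‖ₑ + ‖g p‖ₑ + B.indicator (fun _ => ENNReal.ofReal G) p) ∂ν := by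
          refine lintegral_mono fun p => ?_
          by_cases hp : p ∈ B
          · rw [Set.indicator_of_mem hp, ← ofReal_norm]
            refine le_add_left (ENNReal.ofReal_le_ofReal ?_)
            exact (norm_partialSum_le ha D c p).trans (le_add_of_nonneg_left hM0)
          · refine le_add_right ?_
            rw [← ofReal_norm, ← ofReal_norm (F p), ← ofReal_norm (g p),
              ← ENNReal.ofReal_add (norm_nonneg _) (norm_nonneg _)]
            exact ENNReal.ofReal_le_ofReal (hgle p hp)
      _ = ∫⁻ p, ‖F p‖ₑ ∂ν + ∫⁻ p, ‖g p‖ₑ ∂ν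
          + ∫⁻ p, B.indicator (fun _ => ENNReal.ofReal G) p ∂ν := by
          rw [lintegral_add_left (f := fun p => ‖F p‖ₑ + ‖g p‖ₑ) (hF.enorm.add hg.enorm),
            lintegral_add_left hF.enorm]
      _ ≤ ∫⁻ p, ‖F p‖ₑ ∂ν + ENNReal.ofReal δ + ENNReal.ofReal δ := by
          gcongr
          exact (lintegral_mono' hν le_rfl).trans hgδ

/-! ### Greedy selection of blocks -/

/-- Given approximants `F s` that are dense however late one starts, and integrable functions `P s`,
one can select `σ 0 < σ 1 < ⋯` such that `F (σ j)` approximates what is left of `f` after the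
subtraction of `P (σ 0), …, P (σ (j - 1))`. -/
lemma exists_greedy {ν : Measure (ℝ × ℝ)} {F P : ℕ → ℝ × ℝ → ℂ} (hP : ∀ s, Integrable (P s) ν)
    (hd : ∀ f : ℝ × ℝ → ℂ, Integrable f ν → ∀ η : ℝ, 0 < η → ∀ b, ∃ s ≥ b,
      ∫⁻ p, ‖f p - F s p‖ₑ ∂ν ≤ ENNReal.ofReal η) {f : ℝ × ℝ → ℂ} (hf : Integrable f ν) (s₀ : ℕ) :
    ∃ σ : ℕ → ℕ, StrictMono σ ∧ s₀ ≤ σ 0 ∧ ∀ j,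
      ∫⁻ p, ‖(f p - ∑ i ∈ Finset.range j, P (σ i) p) - F (σ j) p‖ₑ ∂ν
        ≤ ENNReal.ofReal ((1 / 2) ^ j) := by
  have hpick : ∀ (r : ℝ × ℝ → ℂ) (b j : ℕ), ∃ s ≥ b, Integrable r ν →
      ∫⁻ p, ‖r p - F s p‖ₑ ∂ν ≤ ENNReal.ofReal ((1 / 2) ^ j) := by
    intro r b j
    by_cases hr : Integrable r ν
    · obtain ⟨s, hs, h⟩ := hd r hr ((1 / 2) ^ j) (by positivity) b
      exact ⟨s, hs, fun _ => h⟩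
    · exact ⟨b, le_rfl, fun h => absurd h hr⟩
  choose pick hpb hpF using hpick
  -- the state is the remainder together with a lower bound for the next choice
  let st : ℕ → (ℝ × ℝ → ℂ) × ℕ := fun j => Nat.rec (f, s₀)
    (fun j x => (fun p => x.1 p - P (pick x.1 x.2 j) p, pick x.1 x.2 j + 1)) j
  let σ : ℕ → ℕ := fun j => pick (st j).1 (st j).2 j
  have hst : ∀ j, st (j + 1) = (fun p => (st j).1 p - P (σ j) p, σ j + 1) := fun j => rfl
  have hint : ∀ j, Integrable (st j).1 ν := by
    intro j
    induction j with
    | zero => exact hf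
    | succ j ih => rw [hst]; exact ih.sub (hP _)
  have hrem : ∀ j p, (st j).1 p = f p - ∑ i ∈ Finset.range j, P (σ i) p := by
    intro j p
    induction j with
    | zero => simp [st]
    | succ j ih =>
      change (st j).1 p - P (σ j) p = _
      rw [ih, Finset.sum_range_succ]
      ring
  refine ⟨σ, strictMono_nat_of_lt_succ fun j => ?_, hpb _ _ _, fun j => ?_⟩
  · have := hpb (st (j + 1)).1 (st (j + 1)).2 (j + 1)
    rw [hst] at this
    exact Nat.lt_of_succ_le this
  · have := hpF (st j).1 (st j).2 j (hint j)
    simpa only [hrem] using this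

lemma lintegral_enorm_add_le {ν : Measure (ℝ × ℝ)} {f g : ℝ × ℝ → ℂ}
    (hf : AEStronglyMeasurable f ν) :
    ∫⁻ p, ‖f p + g p‖ₑ ∂ν ≤ ∫⁻ p, ‖f p‖ₑ ∂ν + ∫⁻ p, ‖g p‖ₑ ∂ν := by
  rw [← lintegral_add_left' hf.enorm]
  exact lintegral_mono fun p => enorm_add_le _ _

lemma partialSum_eq_sum_finset {a : ℕ} {D : Set (ℕ × ℕ)} {Λ : Finset (ℕ × ℕ)} {c : ℕ × ℕ →₀ ℂ}
    (h : ∀ n ∈ c.support, n ∈ Λ ↔ n ∈ D) (p : ℝ × ℝ) :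
    partialSum a D c p = ∑ n ∈ Λ, c n * walsh2 a p n := by
  classical
  rw [partialSum_eq_sum, ← Finset.sum_filter_add_sum_filter_not Λ (fun n => n ∈ c.support),
    Finset.sum_eq_zero (s := Λ.filter fun n => ¬ n ∈ c.support), add_zero]
  · refine Finset.sum_congr ?_ fun _ _ => rfl
    ext n
    simp only [Finset.mem_filter]
    constructor
    · rintro ⟨h1, h2⟩; exact ⟨(h n h1).2 h2, h1⟩
    · rintro ⟨h1, h2⟩; exact ⟨h2, (h n h2).1 h1⟩
  · intro n hn
    rw [Finsupp.notMem_support_iff.1 (Finset.mem_filter.1 hn).2, zero_mul]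

/-- Along a greedy selection, the union of the spectra of the selected blocks gives a subseries
whose partial sums over lower sets converge, uniformly in the shape of the lower set. -/
theorem exists_subseries {a : ℕ} (ha : 2 ≤ a) {F : ℕ → ℝ × ℝ → ℂ} {M w : ℕ → ℝ} {N : ℕ → ℕ}
    {c : ℕ → ℕ × ℕ →₀ ℂ} {B : ℕ → Set (ℝ × ℝ)} (hN0 : N 0 = 1)
    (hb : ∀ s, IsBlock a (F s) ((1 / 2) ^ (s + 1)) (N s) (N (s + 1)) (c s) (B s))
    (hF : ∀ s, Measurable (F s)) (hM : ∀ s p, ‖F s p‖ ≤ M s) (hF0 : ∀ s p, F s p ≠ 0)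
    (hw : ∀ s, w s * (M s + ∑ n ∈ (c s).support, ‖c s n‖) ≤ (1 / 2) ^ (s + 1))
    {C : ℕ → ℕ → ℂ} (hcC : ∀ s n, c s n ≠ 0 → C n.1 n.2 = c s n)
    {ν : Measure (ℝ × ℝ)} (hν : ν ≤ volume.restrict unitSquare) {s₀ : ℕ}
    (hνB : ∀ s ≥ s₀, ν (B s) ≤ ENNReal.ofReal (w s))
    (hd : ∀ f : ℝ × ℝ → ℂ, Integrable f ν → ∀ η : ℝ, 0 < η → ∀ b, ∃ s ≥ b,
      ∫⁻ p, ‖f p - F s p‖ₑ ∂ν ≤ ENNReal.ofReal η) {f : ℝ × ℝ → ℂ} (hf : Integrable f ν) :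
    ∃ S : Set (ℕ × ℕ), S.Infinite ∧ (∀ n ∈ S, 1 ≤ n.1 ∧ 1 ≤ n.2) ∧
      ∀ K : ℕ, ∃ Q : ℕ, ∀ (D : Set (ℕ × ℕ)) (Λ : Finset (ℕ × ℕ)), IsLowerSet D →
        (∀ n : ℕ × ℕ, 1 ≤ n.1 → 1 ≤ n.2 → (n ∈ Λ ↔ n ∈ D)) →
        (∀ n : ℕ × ℕ, n.1 < Q → n.2 < Q → n ∈ D) →
        ∫⁻ p, ‖∑ n ∈ Λ, subCoeff C S n.1 n.2 * walsh2 a p n - f p‖ₑ ∂ν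
          ≤ ENNReal.ofReal (8 * (1 / 2) ^ (K + 1)) := by
  classical
  have hfin : IsFiniteMeasure ν := isFiniteMeasure_of_le _ hν
  have hN : StrictMono N := strictMono_nat_of_lt_succ fun s => (hb s).lt
  have hsupp := fun s => (hb s).support_subset
  have hN1 : ∀ s, 1 ≤ N s := fun s => hN0 ▸ hN.monotone (Nat.zero_le s)
  have hP : ∀ s, Integrable (partialSum a Set.univ (c s)) ν := fun s =>
    integrable_of_norm_le (measurable_partialSum a _ _) _ (norm_partialSum_le ha _ _)
  have hFi : ∀ s, Integrable (F s) ν := fun s => integrable_of_norm_le (hF s) _ (hM s)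
  have hbound := fun s (hs : s ≥ s₀) => (hb s).lintegral_le ha (hF s) (hM s) (hw s) hν (hνB s hs)
  obtain ⟨σ, hσ, hσ0, hgreedy⟩ := exists_greedy hP hd hf s₀
  have hσs : ∀ j, s₀ ≤ σ j := fun j => hσ0.trans (hσ.monotone (Nat.zero_le j))
  have hpos : ∀ s n, c s n ≠ 0 → 1 ≤ n.1 ∧ 1 ≤ n.2 := fun s n hn =>
    have h := hsupp s (Finsupp.mem_support_iff.2 hn)
    ⟨(hN1 s).trans h.1.1, (hN1 s).trans h.2.1⟩
  have hne : ∀ s, ∃ n, c s n ≠ 0 := by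
    intro s
    by_contra! hzero
    have hc0 : c s = 0 := Finsupp.ext hzero
    -- a vanishing polynomial would force the nonvanishing function `F s` to live on a null set
    have hsub : unitSquare ⊆ B s ∩ unitSquare := by
      refine fun p hp => ⟨?_, hp⟩
      by_contra hpB
      have := (hb s).eq_off p hpB
      rw [hc0, partialSum, map_zero] at this
      exact hF0 s p this.symm
    have h1 : (1 : ENNReal) ≤ ENNReal.ofReal ((1 / 2) ^ (s + 1)) := by
      have hT : volume unitSquare = 1 := by
        rw [← Measure.restrict_apply_univ, measure_univ]
      rw [← hT]
      exact (measure_mono hsub).trans (hb s).volume_le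
    rw [ENNReal.one_le_ofReal] at h1
    have h2 : (1 / 2 : ℝ) ^ (s + 1) < 1 := pow_lt_one₀ (by norm_num) (by norm_num) (by omega)
    linarith
  set r : ℕ → ℝ × ℝ → ℂ := fun j p =>
    f p - ∑ i ∈ Finset.range j, partialSum a Set.univ (c (σ i)) p with hr
  have hri : ∀ j, Integrable (r j) ν := fun j =>
    hf.sub (integrable_finsetSum _ fun i _ => hP (σ i))
  have hsmall : ∀ j, (1 / 2 : ℝ) ^ (σ j) ≤ (1 / 2) ^ j := fun j =>
    pow_le_pow_of_le_one (by norm_num) (by norm_num) (hσ.id_le j)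
  have hrem : ∀ j, ∫⁻ p, ‖r (j + 1) p‖ₑ ∂ν ≤ ENNReal.ofReal (3 * (1 / 2) ^ (j + 1)) := by
    intro j
    have hdec : ∀ p, r (j + 1) p = (r j p - F (σ j) p)
        + (F (σ j) p - partialSum a Set.univ (c (σ j)) p) := by
      intro p; simp only [hr, Finset.sum_range_succ]; ring
    simp_rw [hdec]
    refine (lintegral_enorm_add_le ((hri j).sub (hFi _)).aestronglyMeasurable).trans ?_
    refine (add_le_add (hgreedy j) (hbound _ (hσs j)).1).trans ?_
    rw [← ENNReal.ofReal_add (by positivity) (by positivity)]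
    apply ENNReal.ofReal_le_ofReal
    have := hsmall j
    rw [pow_succ, pow_succ]
    linarith
  refine ⟨{n | ∃ j, c (σ j) n ≠ 0}, ?_, fun n ⟨j, hj⟩ => hpos _ n hj, fun K => ⟨N (σ (K + 1)), ?_⟩⟩
  · choose ν' hν' using hne
    refine Set.infinite_of_injective_forall_mem (f := fun j => ν' (σ j)) (fun i j hij => ?_)
      fun j => ⟨j, hν' _⟩
    have h1 := hν' (σ i)
    rw [show ν' (σ i) = ν' (σ j) from hij] at h1
    exact hσ.injective (eq_of_mem_support hN hsupp h1 (hν' (σ j)))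
  intro D Λ hD hΛ hQ
  -- a number of blocks that covers the finite index set
  obtain ⟨J, hKJ, hJ⟩ : ∃ J, K + 1 ≤ J ∧ ∀ n ∈ Λ, n.1 < N (σ J) := by
    refine ⟨max (K + 1) (Λ.sup Prod.fst + 1), le_max_left _ _, fun n hn => ?_⟩
    have h1 : n.1 ≤ Λ.sup Prod.fst := Finset.le_sup (f := Prod.fst) hn
    have h2 := (hN.comp hσ).id_le (max (K + 1) (Λ.sup Prod.fst + 1))
    have h3 := le_max_right (K + 1) (Λ.sup Prod.fst + 1)
    simp only [id, Function.comp] at h2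
    omega
  have hsum : ∀ p, ∑ n ∈ Λ, subCoeff C {n | ∃ j, c (σ j) n ≠ 0} n.1 n.2 * walsh2 a p n
      = ∑ j ∈ Finset.range J, partialSum a D (c (σ j)) p := by
    intro p
    have h1 : ∀ j, partialSum a D (c (σ j)) p = ∑ n ∈ Λ, c (σ j) n * walsh2 a p n := fun j =>
      partialSum_eq_sum_finset (fun n hn =>
        have h := hpos _ n (Finsupp.mem_support_iff.1 hn)
        hΛ n h.1 h.2) p
    simp_rw [h1]
    rw [Finset.sum_comm]
    refine Finset.sum_congr rfl fun n hn => ?_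
    rw [← Finset.sum_mul]
    congr 1
    by_cases hS : ∃ j, c (σ j) n ≠ 0
    · obtain ⟨j, hj⟩ := hS
      have hjJ : j ∈ Finset.range J := by
        have h2 := (hsupp (σ j) (Finsupp.mem_support_iff.2 hj)).1.1
        exact Finset.mem_range.2 ((hN.comp hσ).lt_iff_lt.1 (h2.trans_lt (hJ n hn)))
      rw [subCoeff, if_pos (show (n.1, n.2) ∈ {n | ∃ j, c (σ j) n ≠ 0} from ⟨j, hj⟩), hcC _ n hj,
        Finset.sum_eq_single_of_mem j hjJ]
      intro i _ hij
      by_contra hi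
      exact hij (hσ.injective (eq_of_mem_support hN hsupp hi hj))
    · rw [subCoeff, if_neg (show (n.1, n.2) ∉ {n | ∃ j, c (σ j) n ≠ 0} from hS)]
      push Not at hS
      exact (Finset.sum_eq_zero fun j _ => hS j).symm
  obtain ⟨t, htJ, htD, ht⟩ := exists_cut (a := a) hD (A := fun j => N (σ j))
    (B := fun j => N (σ j + 1)) (fun i j hij => hN.monotone (Nat.succ_le_of_lt (hσ hij)))
    (fun j => c (σ j)) (fun j => hsupp (σ j)) J
  have hKt : K + 1 ≤ t := by
    rcases htJ.lt_or_eq with h | h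
    · by_contra! hlt
      refine htD h fun n hn => ?_
      have h1 : N (σ t + 1) ≤ N (σ (K + 1)) := hN.monotone (Nat.succ_le_of_lt (hσ hlt))
      exact hQ n (hn.1.2.trans_le h1) (hn.2.2.trans_le h1)
    · omega
  obtain ⟨u, rfl⟩ : ∃ u, t = u + 1 := ⟨t - 1, by omega⟩
  have hFt : ∫⁻ p, ‖F (σ (u + 1)) p‖ₑ ∂ν ≤ ENNReal.ofReal (4 * (1 / 2) ^ (u + 1)) := by
    have hdec : ∀ p, F (σ (u + 1)) p = r (u + 1) p + -(r (u + 1) p - F (σ (u + 1)) p) := by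
      intro p; ring
    rw [lintegral_congr fun p => congrArg _ (hdec p)]
    refine (lintegral_enorm_add_le (hri _).aestronglyMeasurable).trans ?_
    simp_rw [enorm_neg]
    refine (add_le_add (hrem u) (hgreedy (u + 1))).trans ?_
    rw [← ENNReal.ofReal_add (by positivity) (by positivity)]
    apply ENNReal.ofReal_le_ofReal
    linarith
  have hcut : ∫⁻ p, ‖if u + 1 < J then partialSum a D (c (σ (u + 1))) p else 0‖ₑ ∂ν
      ≤ ENNReal.ofReal (5 * (1 / 2) ^ (u + 1)) := by
    calc ∫⁻ p, ‖if u + 1 < J then partialSum a D (c (σ (u + 1))) p else 0‖ₑ ∂ν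
        ≤ ∫⁻ p, ‖partialSum a D (c (σ (u + 1))) p‖ₑ ∂ν :=
          lintegral_mono fun p => by split_ifs <;> simp
      _ ≤ _ := (hbound _ (hσs _)).2 D hD
      _ ≤ ENNReal.ofReal (4 * (1 / 2) ^ (u + 1)) + ENNReal.ofReal ((1 / 2) ^ (σ (u + 1) + 1))
          + ENNReal.ofReal ((1 / 2) ^ (σ (u + 1) + 1)) := by gcongr
      _ ≤ ENNReal.ofReal (5 * (1 / 2) ^ (u + 1)) := by
          rw [← ENNReal.ofReal_add (by positivity) (by positivity),
            ← ENNReal.ofReal_add (by positivity) (by positivity)]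
          apply ENNReal.ofReal_le_ofReal
          have := hsmall (u + 1)
          rw [pow_succ _ (σ (u + 1))]
          linarith
  have hdec : ∀ p, ∑ n ∈ Λ, subCoeff C {n | ∃ j, c (σ j) n ≠ 0} n.1 n.2 * walsh2 a p n - f p
      = -r (u + 1) p + if u + 1 < J then partialSum a D (c (σ (u + 1))) p else 0 := by
    intro p
    rw [hsum, ht]
    simp only [hr]
    ring
  rw [lintegral_congr fun p => congrArg _ (hdec p)]
  refine (lintegral_enorm_add_le (f := fun p => -r (u + 1) p)
    (hri _).neg.aestronglyMeasurable).trans ?_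
  simp_rw [enorm_neg]
  refine (add_le_add (hrem u) hcut).trans ?_
  rw [← ENNReal.ofReal_add (by positivity) (by positivity)]
  apply ENNReal.ofReal_le_ofReal
  have : (1 / 2 : ℝ) ^ (u + 1) ≤ (1 / 2) ^ (K + 1) :=
    pow_le_pow_of_le_one (by norm_num) (by norm_num) hKt
  linarith

/-! ### Rectangular and spherical partial sums -/

lemma rectSum_eq (a : ℕ) (c : ℕ → ℕ → ℂ) (n m : ℕ) (p : ℝ × ℝ) :
    rectSum a c n m p
      = ∑ ν ∈ Finset.Icc 1 n ×ˢ Finset.Icc 1 m, c ν.1 ν.2 * walsh2 a p ν := by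
  rw [rectSum, Finset.sum_product]
  simp only [walsh2, mul_assoc]

open Classical in
lemma sphericalSum_eq (a : ℕ) (c : ℕ → ℕ → ℂ) (R : ℝ) (p : ℝ × ℝ) :
    sphericalSum a c R p
      = ∑ ν ∈ (Finset.Icc 1 ⌊|R|⌋₊ ×ˢ Finset.Icc 1 ⌊|R|⌋₊).filter
          (fun ν => (ν.1 : ℝ) ^ 2 + (ν.2 : ℝ) ^ 2 ≤ R ^ 2), c ν.1 ν.2 * walsh2 a p ν := by
  rw [sphericalSum, Finset.sum_filter, Finset.sum_product]
  simp only [walsh2, mul_assoc]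

lemma isLowerSet_rect (n m : ℕ) : IsLowerSet {ν : ℕ × ℕ | ν.1 ≤ n ∧ ν.2 ≤ m} :=
  fun _ _ h h' => ⟨h.1.trans h'.1, h.2.trans h'.2⟩

lemma isLowerSet_disc (R : ℝ) : IsLowerSet {ν : ℕ × ℕ | (ν.1 : ℝ) ^ 2 + (ν.2 : ℝ) ^ 2 ≤ R ^ 2} := by
  intro x y h h'
  have h1 : (y.1 : ℝ) ≤ x.1 := by exact_mod_cast h.1
  have h2 : (y.2 : ℝ) ≤ x.2 := by exact_mod_cast h.2
  refine le_trans ?_ (show (x.1 : ℝ) ^ 2 + (x.2 : ℝ) ^ 2 ≤ R ^ 2 from h')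
  gcongr

end GenWalsh

open GenWalsh in
theorem theorem3p1 (a : ℕ) (ha : 2 ≤ a) :
    ∃ c : ℕ → ℕ → ℂ,
      (∀ q : ℝ, 2 < q → Summable fun p : ℕ × ℕ => ‖c (p.1 + 1) (p.2 + 1)‖ ^ q) ∧
      ∀ ε : ℝ, 0 < ε →
        ∃ μ : ℝ × ℝ → ℝ, Measurable μ ∧
          (∀ p ∈ GenWalsh.unitSquare, 0 < μ p ∧ μ p ≤ 1) ∧
          MeasureTheory.volume {p ∈ GenWalsh.unitSquare | μ p ≠ 1} < ENNReal.ofReal ε ∧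
          GenWalsh.UniversalConcerningSubseries a c μ := by
  classical
  obtain ⟨F, M, N, c, B, hN0, hb, hF, hM, hF0, hd⟩ := exists_blocks ha
  have hN : StrictMono N := strictMono_nat_of_lt_succ fun s => (hb s).lt
  obtain ⟨C, hcC, hCc⟩ := exists_coeff hN fun s => (hb s).support_subset
  refine ⟨fun n k => C (n, k), fun q hq => ?_, fun ε hε => ?_⟩
  · have h := summable_coeff hcC hCc (fun s => (hb s).norm_le_one) (fun s => (hb s).sum_rpow_le) hq
    have hinj : Function.Injective fun p : ℕ × ℕ => (p.1 + 1, p.2 + 1) := fun x y hxy => by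
      simpa [Prod.ext_iff] using hxy
    exact h.comp_injective hinj
  · set G : ℕ → ℝ := fun s => M s + ∑ n ∈ (c s).support, ‖c s n‖ with hG
    have hG0 : ∀ s, 0 ≤ G s := fun s => add_nonneg ((norm_nonneg _).trans (hM s 0))
      (Finset.sum_nonneg fun _ _ => norm_nonneg _)
    set w : ℕ → ℝ := fun s => (1 / 2) ^ (s + 1) / (1 + G s) with hw
    have hw0 : ∀ s, 0 < w s := fun s => div_pos (by positivity) (by linarith [hG0 s])
    have hw1 : ∀ s, w s ≤ 1 := fun s => by
      have h1 : (1 / 2 : ℝ) ^ (s + 1) ≤ 1 := pow_le_one₀ (by norm_num) (by norm_num)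
      exact div_le_one_of_le₀ (by linarith [hG0 s]) (by linarith [hG0 s])
    have hwG : ∀ s, w s * G s ≤ (1 / 2) ^ (s + 1) := fun s => by
      have h1 : 0 < 1 + G s := by linarith [hG0 s]
      rw [hw, div_mul_eq_mul_div, div_le_iff₀ h1]
      exact mul_le_mul_of_nonneg_left (by linarith) (by positivity)
    obtain ⟨μ, hμm, hμ, hμε, s₀, hs₀⟩ := exists_weight (fun s => (hb s).measurableSet)
      (fun s => (hb s).volume_le) hw0 hw1 hε
    refine ⟨μ, hμm, fun p _ => hμ p, hμε, fun f hf => ?_⟩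
    have hν := weightedMeasure_le fun p => (hμ p).2
    obtain ⟨S, hS, hS1, hconv⟩ := exists_subseries ha hN0 hb hF hM hF0 hwG
      (C := fun n k => C (n, k)) hcC hν hs₀ (hd _ hν) hf
    have hsmall : ∀ η : ENNReal, 0 < η → ∃ K : ℕ, ENNReal.ofReal (8 * (1 / 2) ^ (K + 1)) ≤ η := by
      intro η hη
      have h1 : Tendsto (fun K : ℕ => ENNReal.ofReal (8 * (1 / 2) ^ (K + 1))) atTop (𝓝 0) := by
        have h2 := ((tendsto_pow_atTop_nhds_zero_of_lt_one (r := (1 / 2 : ℝ)) (by norm_num)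
          (by norm_num)).comp (tendsto_add_atTop_nat 1)).const_mul 8
        have h3 := ENNReal.tendsto_ofReal h2
        rwa [mul_zero, ENNReal.ofReal_zero] at h3
      exact (h1.eventually (ge_mem_nhds hη)).exists
    refine ⟨S, hS, hS1, ENNReal.tendsto_nhds_zero.2 fun η hη => ?_,
      ENNReal.tendsto_nhds_zero.2 fun η hη => ?_⟩
    · obtain ⟨K, hK⟩ := hsmall η hη
      obtain ⟨Q, hQ⟩ := hconv K
      filter_upwards [eventually_ge_atTop (Q, Q)] with n hn
      refine le_trans ?_ hK
      simp only [distL1, rectSum_eq]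
      refine hQ _ _ (isLowerSet_rect n.1 n.2) (fun ν h1 h2 => ?_)
        fun ν h1 h2 => ⟨h1.le.trans hn.1, h2.le.trans hn.2⟩
      simp [h1, h2]
    · obtain ⟨K, hK⟩ := hsmall η hη
      obtain ⟨Q, hQ⟩ := hconv K
      filter_upwards [eventually_ge_atTop (2 * Q : ℝ)] with R hR
      refine le_trans ?_ hK
      simp only [distL1, sphericalSum_eq]
      refine hQ _ _ (isLowerSet_disc R) (fun ν h1 h2 => ?_) fun ν h1 h2 => ?_
      · have hle : ∀ x y : ℕ, (x : ℝ) ^ 2 + (y : ℝ) ^ 2 ≤ R ^ 2 → x ≤ ⌊|R|⌋₊ := by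
          intro x y h
          refine Nat.le_floor (abs_le_of_sq_le_sq ?_ (abs_nonneg R) |> (le_abs_self _).trans)
          rw [sq_abs]
          nlinarith [sq_nonneg (y : ℝ)]
        simp only [Finset.mem_filter, Finset.mem_product, Finset.mem_Icc, Set.mem_ofPred_eq]
        exact ⟨fun h => h.2,
          fun h => ⟨⟨⟨h1, hle _ _ h⟩, ⟨h2, hle _ _ (by rwa [add_comm] at h)⟩⟩, h⟩⟩
      · have h3 : (ν.1 : ℝ) ≤ Q := by exact_mod_cast h1.le
        have h4 : (ν.2 : ℝ) ≤ Q := by exact_mod_cast h2.le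
        have h5 : (0 : ℝ) ≤ ν.1 := by positivity
        have h6 : (0 : ℝ) ≤ ν.2 := by positivity
        change (ν.1 : ℝ) ^ 2 + (ν.2 : ℝ) ^ 2 ≤ R ^ 2
        nlinarith
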